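/- Let $(X,\|\cdot\|)$ be a separable real AM-space, that is, a separable real Banach lattice such that $\|x\vee y\|=\max\{\|x\|,\|y\|\}$ for all $x,y\ge 0$ in $X$, and let $c>1$. Then there is a lattice norm $|||\cdot|||$ on $X$ (a norm such that $|x|\le|y|$ implies $|||x|||\le|||y|||$) with $$\|x\|\le|||x|||\le c\,\|x\|\qquad\text{for all }x\in X$$ (in particular, $|||\cdot|||$ is equivalent to $\|\cdot\|$) such that the identity is the only lattice isometry of $(X,|||\cdot|||)$; here a lattice isometry is a surjective linear map $T:X\to X$ with $T(x\vee y)=Tx\vee Ty$, $T(x\wedge y)=Tx\wedge Ty$ and $|||Tx|||=|||x|||$ for all $x,y\in X$. An atom of $X$ is an element $a>0$ such that every $x$ with $0\le x\le a$ is a scalar multiple of $a$. If $X$ has at most one atom up to positive scalar multiples, then the norm $|||\cdot|||$ with all the above properties can in addition be chosen to be an AM-norm, i.e. such that $|||x\vee y|||=\max\{|||x|||,|||y|||\}$ for all $x,y\ge0$. -/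

import Mathlib

section AMDefinitions

variable {X : Type*} [AddCommGroup X] [Lattice X] [Module ℝ X]

/-- A seminorm `N` on a vector lattice is a lattice norm if it is a norm and is monotone
with respect to absolute values. -/
structure IsLatticeNorm (N : Seminorm ℝ X) : Prop where
  eq_zero_of_map_eq_zero : ∀ x : X, N x = 0 → x = 0
  solid : ∀ x y : X, |x| ≤ |y| → N x ≤ N y

/-- An AM-norm is a lattice norm such that the norm of the supremum of two positive elements is
the maximum of their norms. -/
structure IsAMNorm (N : Seminorm ℝ X) : Prop extends IsLatticeNorm N where
  map_sup : ∀ x y : X, 0 ≤ x → 0 ≤ y → N (x ⊔ y) = max (N x) (N y)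

/-- A (surjective, linear) lattice isometry of `(X, N)`. -/
structure IsLatticeIsometry (N : Seminorm ℝ X) (T : X →ₗ[ℝ] X) : Prop where
  surjective : Function.Surjective T
  map_sup : ∀ x y : X, T (x ⊔ y) = T x ⊔ T y
  map_inf : ∀ x y : X, T (x ⊓ y) = T x ⊓ T y
  isometry : ∀ x : X, N (T x) = N x

/-- An atom of a vector lattice: a positive nonzero element `a` such that every element of the
order interval `[0, a]` is a scalar multiple of `a`. (This is not the order-theoretic `IsAtom`.) -/
def IsLatticeAtom (a : X) : Prop :=
  0 < a ∧ ∀ x : X, 0 ≤ x → x ≤ a → ∃ r : ℝ, x = r • a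

variable (X) in
/-- As usual, atoms are counted up to positive scalar multiples
(equivalently, one counts normalized atoms). -/
def HasAtMostOneAtom : Prop :=
  ∀ a b : X, IsLatticeAtom a → IsLatticeAtom b → ∃ r : ℝ, 0 < r ∧ b = r • a

end AMDefinitions

/-! A lattice isometry `T` acts on the real lattice homomorphisms by `φ ↦ φ ∘ T`. In an AM-space
those of norm one norm every vector (`exists_homSphere_abs_eq_norm`), so `T` is the identity once it
fixes a pointwise dense set `D` of them. By separability `D` can be taken countable.

The norm is perturbed so that `φ` gets dual norm `1 / (1 + ε φ)`, where `ε` is summable, positive on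
`D` and zero elsewhere. Two quantities on the rays are transported by `T`, both scaled by the same
factor: the largest multiple `1 + ε φ` of `φ` in the new dual ball, and the height `m φ =
accumHeight φ` at which other rays of the ball accumulate on the ray of `φ`. Only finitely many
values of `ε` exceed a given `δ > 0`, so the perturbation does not change accumulation
(`IsGaugedBy.accum_eq`). Hence `m φ / (1 + ε φ)` is invariant. It is less than 1 on `D` and equal to
1 on the rest of the sphere, so `T` sends rays of `D` to rays of `D`; choosing `ε` with distinct
ratios fixes every ray of `D` with `m φ ≠ 0` (`IsRigidPerturbation.comp_eq`).

A ray with `m φ = 0` belongs to an atom (`exists_isPeakAtom`). The norm `‖x‖ + ∑ ε φ |φ x|`,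
restricted to the span of two atoms, reveals the values of `ε`, and these are distinct, so atoms
cannot be moved either. The norm `sup (1 + ε φ) |φ x|` is an AM-norm; for it the first argument
suffices if there is no second atom to move to. -/

set_option linter.unusedSectionVars false

open Set Filter Topology

/-! ### Real lattice homomorphisms and pointwise compactness -/

section LatticeFunctionals

variable {X : Type*} [NormedAddCommGroup X] [NormedSpace ℝ X] [Lattice X]

/-- Real-valued lattice homomorphisms, as plain functions, so that the set of all of them carries
the topology of pointwise convergence. -/
structure IsRealLatticeHom (φ : X → ℝ) : Prop where
  add : ∀ x y, φ (x + y) = φ x + φ y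
  smul : ∀ (r : ℝ) x, φ (r • x) = r * φ x
  sup : ∀ x y, φ (x ⊔ y) = max (φ x) (φ y)

namespace IsRealLatticeHom

variable {φ ψ : X → ℝ}

lemma zero (h : IsRealLatticeHom φ) : φ 0 = 0 := by simpa using h.smul 0 0

lemma neg (h : IsRealLatticeHom φ) (x : X) : φ (-x) = -φ x := by simpa using h.smul (-1) x

lemma sub (h : IsRealLatticeHom φ) (x y : X) : φ (x - y) = φ x - φ y := by
  rw [sub_eq_add_neg, h.add, h.neg, sub_eq_add_neg]

lemma mono (h : IsRealLatticeHom φ) {x y : X} (hxy : x ≤ y) : φ x ≤ φ y := by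
  have := h.sup x y
  rw [sup_eq_right.2 hxy] at this
  exact this ▸ le_max_left _ _

lemma nonneg (h : IsRealLatticeHom φ) {x : X} (hx : 0 ≤ x) : 0 ≤ φ x := h.zero ▸ h.mono hx

lemma abs (h : IsRealLatticeHom φ) (x : X) : φ |x| = |φ x| := by
  simp only [_root_.abs, h.sup, h.neg]

lemma posPart (h : IsRealLatticeHom φ) (x : X) : φ x⁺ = max (φ x) 0 := by
  rw [posPart_def, h.sup, h.zero]

lemma const_smul (h : IsRealLatticeHom φ) {r : ℝ} (hr : 0 ≤ r) : IsRealLatticeHom (r • φ) where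
  add x y := by simp [h.add, mul_add]
  smul s x := by simp [h.smul]; ring
  sup x y := by simp [h.sup, mul_max_of_nonneg _ _ hr]

lemma comp (h : IsRealLatticeHom φ) {N : Seminorm ℝ X} {T : X →ₗ[ℝ] X}
    (hT : IsLatticeIsometry N T) : IsRealLatticeHom (φ ∘ T) where
  add x y := by simp [h.add]
  smul s x := by simp [h.smul]
  sup x y := by simp [hT.map_sup, h.sup]

lemma exists_nonneg_eq_one [IsOrderedAddMonoid X] [IsOrderedModule ℝ X]
    (h : IsRealLatticeHom φ) (h0 : φ ≠ 0) : ∃ x, 0 ≤ x ∧ φ x = 1 := by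
  obtain ⟨x, hx⟩ := Function.ne_iff.1 h0
  refine ⟨|φ x|⁻¹ • |x|, smul_nonneg (by positivity) (abs_nonneg x), ?_⟩
  rw [h.smul, h.abs, inv_mul_cancel₀ (abs_ne_zero.2 hx)]

section
variable [IsOrderedAddMonoid X]

lemma inf (h : IsRealLatticeHom φ) (x y : X) : φ (x ⊓ y) = min (φ x) (φ y) := by
  have := h.sup (-x) (-y)
  rw [← neg_inf, h.neg, h.neg, h.neg, max_neg_neg] at this
  linarith

end

end IsRealLatticeHom

/-- Two lattice homomorphisms on different rays are separated by a positive element. -/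
lemma IsRealLatticeHom.exists_separating [IsOrderedAddMonoid X] [IsOrderedModule ℝ X]
    {φ ψ : X → ℝ} (hφ : IsRealLatticeHom φ)
    (hψ : IsRealLatticeHom ψ) (h0 : φ ≠ 0) (h : ∀ r : ℝ, 0 < r → ψ ≠ r • φ) :
    ∃ x, 0 ≤ x ∧ φ x = 1 ∧ ψ x = 0 := by
  obtain ⟨w, hw, hφw⟩ := hφ.exists_nonneg_eq_one h0
  -- If `ker φ ⊆ ker ψ`, then `ψ = ψ w • φ`, and `ψ w` cannot be positive. Otherwise `w` is
  -- corrected along a vector of `ker φ` on which `ψ` does not vanish. The positive part of `y` then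
  -- separates.
  have key : ∃ y, φ y = 1 ∧ ψ y ≤ 0 := by
    by_cases hker : ∀ z, φ z = 0 → ψ z = 0
    · have hψφ : ψ = ψ w • φ := by
        funext z
        have := hker (z - φ z • w) (by rw [hφ.sub, hφ.smul, hφw]; ring)
        rw [hψ.sub, hψ.smul] at this
        simp only [Pi.smul_apply, smul_eq_mul]
        linarith
      refine ⟨w, hφw, ?_⟩
      by_contra! hlt
      exact h _ hlt hψφ
    · push Not at hker
      obtain ⟨z, hz, hz'⟩ := hker
      refine ⟨w - (ψ w / ψ z) • z, ?_, ?_⟩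
      · rw [hφ.sub, hφ.smul, hz, hφw]; ring
      · rw [hψ.sub, hψ.smul, div_mul_cancel₀ _ hz']; simp
  obtain ⟨y, hy, hy'⟩ := key
  exact ⟨y⁺, posPart_nonneg y, by rw [hφ.posPart, hy]; norm_num, by rw [hψ.posPart]; simpa⟩

/-- The lattice homomorphisms dominated by a seminorm. -/
def homBall (N : Seminorm ℝ X) : Set (X → ℝ) :=
  {φ | IsRealLatticeHom φ ∧ ∀ x, |φ x| ≤ N x}

variable (X) in
/-- The lattice homomorphisms of norm one. -/
def homSphere : Set (X → ℝ) :=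
  {φ | φ ∈ homBall (normSeminorm ℝ X) ∧ ∀ r : ℝ, (∀ x, r * |φ x| ≤ ‖x‖) → r ≤ 1}

/-- Tychonoff: each defining condition involves finitely many evaluations and is therefore closed in
a product of intervals. -/
lemma isCompact_homBall (N : Seminorm ℝ X) : IsCompact (homBall N) := by
  refine IsCompact.of_isClosed_subset
    (isCompact_univ_pi fun x : X => isCompact_Icc (a := -N x) (b := N x)) ?_ ?_
  · have : homBall N = (⋂ (x : X) (y : X), {φ : X → ℝ | φ (x + y) = φ x + φ y}) ∩
        (⋂ (r : ℝ) (x : X), {φ : X → ℝ | φ (r • x) = r * φ x}) ∩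
        (⋂ (x : X) (y : X), {φ : X → ℝ | φ (x ⊔ y) = max (φ x) (φ y)}) ∩
        ⋂ x : X, {φ : X → ℝ | |φ x| ≤ N x} := by
      ext φ
      simp only [homBall, mem_ofPred_eq, mem_inter_iff, mem_iInter]
      exact ⟨fun h => ⟨⟨⟨h.1.add, h.1.smul⟩, h.1.sup⟩, h.2⟩,
        fun h => ⟨⟨h.1.1.1, h.1.1.2, h.1.2⟩, h.2⟩⟩
    rw [this]
    refine IsClosed.inter (IsClosed.inter (IsClosed.inter ?_ ?_) ?_) ?_
    · exact isClosed_iInter fun x => isClosed_iInter fun y =>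
        isClosed_eq (by fun_prop) (by fun_prop)
    · exact isClosed_iInter fun x => isClosed_iInter fun y =>
        isClosed_eq (by fun_prop) (by fun_prop)
    · exact isClosed_iInter fun x => isClosed_iInter fun y =>
        isClosed_eq (by fun_prop) (by fun_prop)
    · exact isClosed_iInter fun x => isClosed_le (by fun_prop) (by fun_prop)
  · intro φ hφ x _
    exact abs_le.1 (hφ.2 x)

/-- A pointwise dense countable subset of a family of contractions on a separable space. -/
lemma exists_countable_subset_closure {E : Type*} [PseudoMetricSpace E]
    [TopologicalSpace.SeparableSpace E] [Nonempty E] (A : Set (E → ℝ))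
    (hA : ∀ φ ∈ A, LipschitzWith 1 φ) : ∃ D ⊆ A, D.Countable ∧ A ⊆ closure D := by
  let e : A → ℕ → ℝ := fun φ n => φ.1 (TopologicalSpace.denseSeq E n)
  -- For 1-Lipschitz functions, convergence on a dense sequence implies pointwise convergence, so
  -- `A` embeds topologically in `ℕ → ℝ` and is second countable.
  have he : IsInducing e := by
    rw [isInducing_iff_nhds]
    intro φ
    apply le_antisymm
    · have : Continuous e := by
        refine continuous_pi fun n => ?_
        exact (continuous_apply _).comp continuous_subtype_val
      exact this.continuousAt.le_comap
    · suffices Tendsto (fun ψ : A => ψ.1) (comap e (𝓝 (e φ))) (𝓝 φ.1) by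
        rw [nhds_subtype_eq_comap]
        exact this.le_comap
      rw [tendsto_pi_nhds]
      intro x
      rw [Metric.tendsto_nhds]
      intro δ hδ
      obtain ⟨n, hn⟩ := (TopologicalSpace.denseRange_denseSeq E).exists_dist_lt x
        (show 0 < δ / 3 by positivity)
      have h1 : Tendsto (fun ψ : A => e ψ n) (comap e (𝓝 (e φ))) (𝓝 (e φ n)) :=
        ((continuous_apply n).tendsto (e φ)).comp tendsto_comap
      filter_upwards [(Metric.tendsto_nhds.1 h1) (δ / 3) (by positivity)] with ψ hψ
      have a1 := (hA _ ψ.2).dist_le_mul x (TopologicalSpace.denseSeq E n)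
      have a2 := (hA _ φ.2).dist_le_mul x (TopologicalSpace.denseSeq E n)
      simp only [Real.dist_eq, NNReal.coe_one, one_mul, e] at *
      rw [abs_lt] at *
      rw [abs_le] at a1 a2
      constructor <;> linarith [hψ.1, hψ.2, a1.1, a1.2, a2.1, a2.2]
  have := he.secondCountableTopology
  obtain ⟨s, hs, hs'⟩ := TopologicalSpace.exists_countable_dense A
  exact ⟨Subtype.val '' s, by simp, hs.image _, fun x hx => Subtype.dense_iff.1 hs' hx⟩

lemma IsRealLatticeHom.lipschitzWith {φ : X → ℝ} (h : φ ∈ homBall (normSeminorm ℝ X)) :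
    LipschitzWith 1 φ := by
  refine LipschitzWith.of_dist_le_mul fun x y => ?_
  rw [Real.dist_eq, ← h.1.sub, dist_eq_norm, NNReal.coe_one, one_mul]
  exact h.2 _

end LatticeFunctionals

/-! ### Norming by lattice homomorphisms (Hahn–Banach and Krein–Milman) -/

section Norming

variable {X : Type*} [NormedAddCommGroup X] [NormedSpace ℝ X] [Lattice X]

/-- Hahn–Banach: a sublinear functional is the maximum of the linear functionals below it. -/
lemma exists_isLinearMap_le_sublinear {E : Type*} [AddCommGroup E] [Module ℝ E] (p : E → ℝ)
    (p_hom : ∀ c : ℝ, 0 < c → ∀ x, p (c • x) = c * p x) (p_add : ∀ x y, p (x + y) ≤ p x + p y)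
    (y : E) : ∃ g : E → ℝ, IsLinearMap ℝ g ∧ g y = p y ∧ ∀ x, g x ≤ p x := by
  have p0 : p 0 = 0 := by
    have := p_hom 2 two_pos 0
    rw [smul_zero] at this
    linarith
  have H : ∀ r : ℝ, r • y = 0 → (RingHom.id ℝ r) • p y = 0 := fun r hr => by
    rcases smul_eq_zero.1 hr with rfl | rfl <;> simp [p0]
  obtain ⟨g, hg, hg'⟩ := exists_extension_of_le_sublinear
    (LinearPMap.mkSpanSingleton' y (p y) H) p p_hom p_add (by
      rintro ⟨x, hx⟩
      obtain ⟨r, rfl⟩ := Submodule.mem_span_singleton.1 hx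
      rw [LinearPMap.mkSpanSingleton'_apply, RingHom.id_apply, smul_eq_mul]
      rcases lt_trichotomy r 0 with hr | rfl | hr
      · have h1 := p_hom (-r) (neg_pos.2 hr) y
        have h2 := p_add (r • y) (-r • y)
        rw [neg_smul, add_neg_cancel, p0] at h2
        rw [neg_smul] at h1
        linarith
      · simp [p0]
      · exact (p_hom r hr y).ge)
  refine ⟨g, g.isLinear, ?_, hg'⟩
  rw [hg ⟨y, Submodule.mem_span_singleton_self y⟩]
  exact LinearPMap.mkSpanSingleton'_apply_self _ _ _ _

variable [IsOrderedAddMonoid X] [IsOrderedModule ℝ X]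

lemma posPart_add_le_add (x y : X) : (x + y)⁺ ≤ x⁺ + y⁺ := by
  rw [posPart_def (x + y)]
  exact sup_le (add_le_add (le_posPart x) (le_posPart y))
    (add_nonneg (posPart_nonneg x) (posPart_nonneg y))

lemma posPart_smul_of_pos {r : ℝ} (hr : 0 < r) (x : X) : (r • x)⁺ = r • x⁺ := by
  rw [posPart_def, posPart_def]
  apply le_antisymm
  · refine sup_le (smul_le_smul_of_nonneg_left le_sup_left hr.le) ?_
    exact smul_nonneg hr.le le_sup_right
  · rw [← le_inv_smul_iff_of_pos hr]
    refine sup_le ?_ ?_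
    · rw [le_inv_smul_iff_of_pos hr]; exact le_sup_left
    · rw [le_inv_smul_iff_of_pos hr, smul_zero]; exact le_sup_right

/-- The positive linear functionals of norm at most one. -/
def positiveFunctionalBall (X : Type*) [NormedAddCommGroup X] [NormedSpace ℝ X] [Lattice X] :
    Set (X → ℝ) :=
  {φ | IsLinearMap ℝ φ ∧ ∀ x, φ x ≤ ‖x⁺‖}

variable [HasSolidNorm X]

lemma norm_le_norm_of_nonneg_of_le {x y : X} (hx : 0 ≤ x) (hxy : x ≤ y) : ‖x‖ ≤ ‖y‖ :=
  norm_le_norm_of_abs_le_abs (by rwa [abs_of_nonneg hx, abs_of_nonneg (hx.trans hxy)])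

lemma norm_posPart_le_norm (x : X) : ‖x⁺‖ ≤ ‖x‖ := by
  rw [← norm_abs_eq_norm x]
  exact norm_le_norm_of_nonneg_of_le (posPart_nonneg x) (sup_le (le_abs_self x) (abs_nonneg x))

lemma abs_le_norm_of_le_norm_posPart {φ : X → ℝ} (h : φ ∈ positiveFunctionalBall X) (x : X) :
    |φ x| ≤ ‖x‖ := by
  rw [abs_le]
  constructor
  · have := (h.2 (-x)).trans (norm_posPart_le_norm (-x))
    rw [h.1.map_neg, norm_neg] at this
    linarith
  · exact (h.2 x).trans (norm_posPart_le_norm x)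

lemma isCompact_positiveFunctionalBall : IsCompact (positiveFunctionalBall X) := by
  refine IsCompact.of_isClosed_subset
    (isCompact_univ_pi fun x : X => isCompact_Icc (a := -‖x‖) (b := ‖x‖)) ?_ ?_
  · have : positiveFunctionalBall X = (⋂ (x : X) (y : X), {φ : X → ℝ | φ (x + y) = φ x + φ y}) ∩
        (⋂ (r : ℝ) (x : X), {φ : X → ℝ | φ (r • x) = r * φ x}) ∩
        ⋂ x : X, {φ : X → ℝ | φ x ≤ ‖x⁺‖} := by
      ext φ
      simp only [positiveFunctionalBall, mem_ofPred_eq, mem_inter_iff, mem_iInter]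
      exact ⟨fun h => ⟨⟨h.1.map_add, h.1.map_smul⟩, h.2⟩, fun h => ⟨⟨h.1.1, h.1.2⟩, h.2⟩⟩
    rw [this]
    refine IsClosed.inter (IsClosed.inter ?_ ?_) ?_
    · exact isClosed_iInter fun x => isClosed_iInter fun y =>
        isClosed_eq (by fun_prop) (by fun_prop)
    · exact isClosed_iInter fun x => isClosed_iInter fun y =>
        isClosed_eq (by fun_prop) (by fun_prop)
    · exact isClosed_iInter fun x => isClosed_le (by fun_prop) (by fun_prop)
  · intro φ hφ x _
    exact abs_le.1 (abs_le_norm_of_le_norm_posPart hφ x)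

lemma norm_posPart_add_le (x y : X) : ‖(x + y)⁺‖ ≤ ‖x⁺‖ + ‖y⁺‖ :=
  (norm_le_norm_of_nonneg_of_le (posPart_nonneg _) (posPart_add_le_add x y)).trans
    (norm_add_le _ _)

/-- Positive functionals of norm one on a space with AM-norm decompose additively: if
`0 ≤ ψ ≤ φ ≤ 1` and `φ x = 1`, then the norm of `ψ` is at most `ψ x`. -/
lemma le_mul_norm_posPart_of_le (hX : IsAMNorm (normSeminorm ℝ X)) {x : X} (hx : 0 ≤ x)
    (hx1 : ‖x‖ = 1) {φ ψ : X → ℝ} (hφ : φ ∈ positiveFunctionalBall X) (hφx : φ x = 1)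
    (hψ : IsLinearMap ℝ ψ) (hψ0 : ∀ z, 0 ≤ z → 0 ≤ ψ z) (hψφ : ∀ z, 0 ≤ z → ψ z ≤ φ z) (u : X) :
    ψ u ≤ ψ x * ‖u⁺‖ := by
  have mono : ∀ a b, a ≤ b → ψ a ≤ ψ b := fun a b hab => by
    have := hψ0 (b - a) (sub_nonneg.2 hab)
    rw [hψ.map_sub] at this
    linarith
  have unit : ∀ v, 0 ≤ v → ‖v‖ ≤ 1 → ψ v ≤ ψ x := by
    intro v hv hv1
    -- The AM-property enters here: `φ` is already maximal at `x`, so passing from `x` to `v ⊔ x`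
    -- cannot increase `φ`, nor therefore `ψ ≤ φ`.
    have h1 : ‖v ⊔ x‖ ≤ 1 := by
      have := hX.map_sup v x hv hx
      simp only [coe_normSeminorm] at this
      rw [this, hx1]
      exact max_le hv1 le_rfl
    have h2 : φ (v ⊔ x) ≤ 1 :=
      (le_abs_self _).trans ((abs_le_norm_of_le_norm_posPart hφ _).trans h1)
    have h3 := mono v (v ⊔ x) le_sup_left
    have h4 := hψφ (v ⊔ x - x) (sub_nonneg.2 le_sup_right)
    rw [hφ.1.map_sub, hψ.map_sub] at h4
    linarith
  have scaled : ∀ v, 0 ≤ v → ψ v ≤ ψ x * ‖v‖ := by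
    intro v hv
    rcases eq_or_ne v 0 with rfl | hv0
    · simp [hψ.map_zero]
    · have hn : 0 < ‖v‖ := norm_pos_iff.2 hv0
      have := unit (‖v‖⁻¹ • v) (smul_nonneg (by positivity) hv)
        (by rw [norm_smul, norm_inv, norm_norm, inv_mul_cancel₀ hn.ne'])
      rw [hψ.map_smul, smul_eq_mul, inv_mul_le_iff₀ hn] at this
      linarith
  exact (mono u u⁺ (le_posPart u)).trans (scaled _ (posPart_nonneg u))

/-- Extremality forces every `ψ` with `0 ≤ ψ ≤ φ` to be a multiple of `φ`: by
`le_mul_norm_posPart_of_le` the norms of `ψ` and `φ - ψ` are at most `ψ x` and `1 - ψ x`, so `φ` is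
a convex combination of their normalizations. Applied to a `ψ` with `ψ y = φ y⁺`, this shows that
`φ` vanishes on `y⁺` or on `y⁻`. -/
lemma isRealLatticeHom_of_mem_extremePoints (hX : IsAMNorm (normSeminorm ℝ X)) {x : X}
    (hx : 0 ≤ x) (hx1 : ‖x‖ = 1) {φ : X → ℝ}
    (hφ : φ ∈ extremePoints ℝ {φ ∈ positiveFunctionalBall X | φ x = 1}) :
    IsRealLatticeHom φ := by
  obtain ⟨⟨hφB, hφx⟩, hext⟩ := hφ
  have lin := hφB.1
  have φ0 : ∀ z, 0 ≤ z → 0 ≤ φ z := fun z hz => by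
    have := hφB.2 (-z)
    rw [lin.map_neg, posPart_eq_zero.2 (by simpa using hz), norm_zero] at this
    linarith
  have mono : ∀ a b, a ≤ b → φ a ≤ φ b := fun a b hab => by
    have := φ0 (b - a) (sub_nonneg.2 hab)
    rw [lin.map_sub] at this
    linarith
  have key : ∀ y, φ y⁺ = 0 ∨ φ y⁻ = 0 := by
    intro y
    obtain ⟨ψ, hψ, hψy, hψle⟩ := exists_isLinearMap_le_sublinear (fun z => φ z⁺)
      (fun r hr z => by simp only [posPart_smul_of_pos hr, lin.map_smul, smul_eq_mul])
      (fun a b => by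
        rw [← lin.map_add]
        exact mono _ _ (posPart_add_le_add a b)) y
    have ψ0 : ∀ z, 0 ≤ z → 0 ≤ ψ z := fun z hz => by
      have := hψle (-z)
      simp only [hψ.map_neg, posPart_eq_zero.2 (show -z ≤ 0 by simpa using hz),
        lin.map_zero] at this
      linarith
    have ψφ : ∀ z, 0 ≤ z → ψ z ≤ φ z := fun z hz => by
      have := hψle z
      rwa [posPart_eq_self.2 hz] at this
    have hχ : IsLinearMap ℝ (φ - ψ) := ⟨fun a b => by simp [lin.map_add, hψ.map_add]; ring,
      fun r a => by simp [lin.map_smul, hψ.map_smul]; ring⟩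
    have b1 := le_mul_norm_posPart_of_le hX hx hx1 hφB hφx hψ ψ0 ψφ
    have b2 := le_mul_norm_posPart_of_le hX hx hx1 hφB hφx hχ
      (fun z hz => by simpa using ψφ z hz) (fun z hz => by simpa using ψ0 z hz)
    have hα0 := ψ0 x hx
    have hα1 := ψφ x hx
    rw [hφx] at hα1
    have prop : ∀ z, ψ z = ψ x * φ z := by
      have neg_of : ∀ {θ : X → ℝ}, IsLinearMap ℝ θ → (∀ u, θ u ≤ 0 * ‖u⁺‖) → ∀ z, θ z = 0 := by
        intro θ hθ h z
        have h1 := h z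
        have h2 := h (-z)
        rw [hθ.map_neg] at h2
        linarith
      -- At the endpoints `ψ x = 0` and `ψ x = 1` normalization is impossible, but then `ψ` or `φ -
      -- ψ` is zero by its norm bound.
      rcases hα0.eq_or_lt with h0 | h0
      · intro z
        rw [neg_of hψ (by rwa [← h0] at b1) z, ← h0, zero_mul]
      rcases hα1.eq_or_lt with h1 | h1
      · intro z
        have := neg_of hχ (by simpa [hφx, h1] using b2) z
        simp only [Pi.sub_apply] at this
        rw [h1]
        linarith
      have e := hext (x₁ := (ψ x)⁻¹ • ψ)
        ⟨⟨⟨fun a b => by simp [hψ.map_add, mul_add],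
            fun r a => by simp [hψ.map_smul]; ring⟩, fun u => by
              simp only [Pi.smul_apply, smul_eq_mul]
              rw [inv_mul_le_iff₀ h0]
              exact b1 u⟩, by simp [h0.ne']⟩
        (x₂ := (1 - ψ x)⁻¹ • (φ - ψ))
        ⟨⟨⟨fun a b => by simp only [Pi.smul_apply, smul_eq_mul, hχ.map_add, mul_add],
            fun r a => by simp only [Pi.smul_apply, hχ.map_smul, smul_eq_mul]; ring⟩, fun u => by
              simp only [Pi.smul_apply, smul_eq_mul]
              rw [inv_mul_le_iff₀ (by linarith)]
              have := b2 u
              simpa [hφx] using this⟩, by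
                have : 1 - ψ x ≠ 0 := by linarith
                simp [hφx, this]⟩
        ⟨ψ x, 1 - ψ x, h0, by linarith, by ring, by
          have : 1 - ψ x ≠ 0 := by linarith
          rw [smul_inv_smul₀ h0.ne', smul_inv_smul₀ this]
          simp⟩
      intro z
      have := congrFun e z
      simp only [Pi.smul_apply, smul_eq_mul] at this
      rw [← this, mul_inv_cancel_left₀ h0.ne']
    have c1 : ψ y = ψ y⁺ - ψ y⁻ := by rw [← hψ.map_sub, posPart_sub_negPart]
    have c2 := ψφ y⁺ (posPart_nonneg y)
    have c3 := ψ0 y⁻ (negPart_nonneg y)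
    -- Equality holds in `φ y⁺ = ψ y = ψ y⁺ - ψ y⁻ ≤ φ y⁺`.
    have c4 : ψ y⁻ = 0 := by linarith
    rw [prop, mul_eq_zero] at c4
    rcases c4 with h | h
    · left
      rw [← hψy, prop, h, zero_mul]
    · exact Or.inr h
  have hpos : ∀ y, φ y⁺ = max (φ y) 0 := by
    intro y
    have c1 : φ y = φ y⁺ - φ y⁻ := by rw [← lin.map_sub, posPart_sub_negPart]
    have c2 := φ0 y⁺ (posPart_nonneg y)
    have c3 := φ0 y⁻ (negPart_nonneg y)
    rcases key y with h | h
    · rw [max_eq_right] <;> linarith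
    · rw [max_eq_left] <;> linarith
  refine ⟨lin.map_add, lin.map_smul, fun a b => ?_⟩
  rw [sup_eq_add_posPart_sub, lin.map_add, hpos, lin.map_sub, ← max_add_add_left]
  simp

/-- In an AM-space every vector is normed by a lattice homomorphism. -/
theorem exists_homSphere_abs_eq_norm (hX : IsAMNorm (normSeminorm ℝ X)) {x : X} (hx : x ≠ 0) :
    ∃ φ ∈ homSphere X, |φ x| = ‖x‖ := by
  have hn : 0 < ‖x‖ := norm_pos_iff.2 hx
  set y : X := ‖x‖⁻¹ • |x| with hy
  have hy0 : 0 ≤ y := smul_nonneg (by positivity) (abs_nonneg x)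
  have hy1 : ‖y‖ = 1 := by
    rw [hy, norm_smul, norm_inv, norm_norm, norm_abs_eq_norm, inv_mul_cancel₀ hn.ne']
  have hne : {φ ∈ positiveFunctionalBall X | φ y = 1}.Nonempty := by
    obtain ⟨g, hg, hgy, hg'⟩ := exists_isLinearMap_le_sublinear (fun z : X => ‖z⁺‖)
      (fun r hr z => by simp only [posPart_smul_of_pos hr, norm_smul, Real.norm_of_nonneg hr.le])
      norm_posPart_add_le y
    exact ⟨g, ⟨hg, hg'⟩, by rw [hgy, posPart_eq_self.2 hy0, hy1]⟩
  have hcomp : IsCompact {φ ∈ positiveFunctionalBall X | φ y = 1} :=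
    isCompact_positiveFunctionalBall.inter_right
      (isClosed_eq (continuous_apply y) continuous_const)
  obtain ⟨φ, hφ⟩ := hcomp.extremePoints_nonempty hne
  have hom := isRealLatticeHom_of_mem_extremePoints hX hy0 hy1 hφ
  have hφx : |φ x| = ‖x‖ := by
    have := hφ.1.2
    rw [hy, hom.smul, hom.abs, inv_mul_eq_one₀ hn.ne'] at this
    exact this.symm
  refine ⟨φ, ⟨⟨hom, abs_le_norm_of_le_norm_posPart hφ.1.1⟩, fun r hr => ?_⟩, hφx⟩
  have := hr x
  rw [hφx] at this
  exact (mul_le_iff_le_one_left hn).1 this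

/-- Lattice homomorphisms of norm one detect equality. -/
lemma eq_of_forall_homSphere (hX : IsAMNorm (normSeminorm ℝ X)) {x y : X}
    (h : ∀ φ ∈ homSphere X, φ x = φ y) : x = y := by
  by_contra hne
  obtain ⟨φ, hφ, hφx⟩ := exists_homSphere_abs_eq_norm hX (sub_ne_zero.2 hne)
  rw [hφ.1.1.sub, h φ hφ, sub_self, abs_zero] at hφx
  exact hne (sub_eq_zero.1 (norm_eq_zero.1 hφx.symm))

end Norming

/-! ### Accumulation of rays, and atoms as isolated rays -/

section Accumulation

variable {X : Type*} [NormedAddCommGroup X] [NormedSpace ℝ X] [Lattice X]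

/-- The functionals of `homBall N` that are not on the line through `φ`. -/
def offRay (N : Seminorm ℝ X) (φ : X → ℝ) : Set (X → ℝ) := {ψ ∈ homBall N | ∀ r : ℝ, ψ ≠ r • φ}

/-- The positive multiples of `φ` that are pointwise limits of functionals of `homBall N` from
outside the line through `φ`. -/
def accum (N : Seminorm ℝ X) (φ : X → ℝ) : Set ℝ := {t | 0 < t ∧ t • φ ∈ closure (offRay N φ)}

/-- The height at which the ray of `φ` is approximated by other rays of the unit ball. -/
noncomputable def accumHeight (φ : X → ℝ) : ℝ := sSup (accum (normSeminorm ℝ X) φ)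

lemma homSphere_ne_zero {φ : X → ℝ} (hφ : φ ∈ homSphere X) : φ ≠ 0 := by
  rintro rfl
  have := hφ.2 2 (by simp)
  norm_num at this

lemma homSphere_eq_of_smul {φ ψ : X → ℝ} (hφ : φ ∈ homSphere X) (hψ : ψ ∈ homSphere X) {u : ℝ}
    (hu : 0 ≤ u) (h : φ = u • ψ) : φ = ψ := by
  have h1 : u ≤ 1 := hψ.2 u fun x => by
    have := hφ.1.2 x
    rwa [h, Pi.smul_apply, smul_eq_mul, abs_mul, abs_of_nonneg hu] at this
  have h0 : u ≠ 0 := by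
    rintro rfl
    exact homSphere_ne_zero hφ (by simpa using h)
  have hu0 : 0 < u := lt_of_le_of_ne hu h0.symm
  have h2 : u⁻¹ ≤ 1 := hφ.2 _ fun x => by
    rw [h, Pi.smul_apply, smul_eq_mul, abs_mul, abs_of_nonneg hu, inv_mul_cancel_left₀ h0]
    exact hψ.1.2 x
  have : u = 1 := le_antisymm h1 ((inv_le_one₀ hu0).1 h2)
  rw [h, this, one_smul]

section
variable [IsOrderedAddMonoid X] [IsOrderedModule ℝ X]

lemma nonneg_of_eq_smul {φ ψ : X → ℝ} (hφ : IsRealLatticeHom φ) (hψ : IsRealLatticeHom ψ)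
    (h0 : φ ≠ 0) {r : ℝ} (h : ψ = r • φ) : 0 ≤ r := by
  obtain ⟨w, hw, hw1⟩ := hφ.exists_nonneg_eq_one h0
  have := hψ.nonneg hw
  rw [h] at this
  simpa [hw1] using this

lemma homSphere_eq_of_eq_smul {φ ψ : X → ℝ} (hφ : φ ∈ homSphere X) (hψ : ψ ∈ homSphere X) {r : ℝ}
    (h : ψ = r • φ) : ψ = φ :=
  homSphere_eq_of_smul hψ hφ (nonneg_of_eq_smul hφ.1.1 hψ.1.1 (homSphere_ne_zero hφ) h) h
end

lemma closure_offRay_subset (N : Seminorm ℝ X) (φ : X → ℝ) : closure (offRay N φ) ⊆ homBall N :=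
  closure_minimal (fun _ h => h.1) (isCompact_homBall N).isClosed

lemma le_one_of_mem_accum {φ : X → ℝ} (hφ : φ ∈ homSphere X) {t : ℝ}
    (ht : t ∈ accum (normSeminorm ℝ X) φ) : t ≤ 1 := by
  refine hφ.2 t fun x => ?_
  have := (closure_offRay_subset _ _ ht.2).2 x
  rwa [Pi.smul_apply, smul_eq_mul, abs_mul, abs_of_pos ht.1] at this

lemma bddAbove_accum {φ : X → ℝ} (hφ : φ ∈ homSphere X) :
    BddAbove (accum (normSeminorm ℝ X) φ) := ⟨1, fun _ => le_one_of_mem_accum hφ⟩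

lemma accumHeight_nonneg (φ : X → ℝ) : 0 ≤ accumHeight φ := Real.sSup_nonneg fun _ h => h.1.le

/-- Every nonzero bounded lattice homomorphism is a multiple of one of norm one. -/
lemma exists_homSphere_smul {χ : X → ℝ} (hχ : IsRealLatticeHom χ) (h0 : χ ≠ 0) {C : ℝ}
    (hC : ∀ x, |χ x| ≤ C * ‖x‖) : ∃ u : ℝ, 0 < u ∧ ∃ ψ ∈ homSphere X, χ = u • ψ := by
  set A : Set ℝ := {K | 0 ≤ K ∧ ∀ x, |χ x| ≤ K * ‖x‖} with hA
  have hAb : BddBelow A := ⟨0, fun _ h => h.1⟩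
  have hne : A.Nonempty := ⟨max C 0, le_max_right _ _, fun x =>
    (hC x).trans (mul_le_mul_of_nonneg_right (le_max_left _ _) (norm_nonneg x))⟩
  set u := sInf A
  have hu0 : 0 ≤ u := le_csInf hne fun _ h => h.1
  have hu : ∀ x, |χ x| ≤ u * ‖x‖ := by
    intro x
    rcases eq_or_ne x 0 with rfl | hx
    · simp [hχ.zero]
    · have hn : 0 < ‖x‖ := norm_pos_iff.2 hx
      rw [← div_le_iff₀ hn]
      exact le_csInf hne fun K hK => (div_le_iff₀ hn).2 (hK.2 x)
  have hupos : 0 < u := by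
    refine lt_of_le_of_ne hu0 fun h => h0 ?_
    funext x
    have := hu x
    rw [← h, zero_mul] at this
    exact abs_nonpos_iff.1 this
  refine ⟨u, hupos, u⁻¹ • χ, ⟨⟨hχ.const_smul (by positivity), fun x => ?_⟩, fun r hr => ?_⟩,
    (smul_inv_smul₀ hupos.ne' χ).symm⟩
  · rw [Pi.smul_apply, smul_eq_mul, abs_mul, abs_of_pos (inv_pos.2 hupos), inv_mul_le_iff₀ hupos]
    exact hu x
  · by_contra! h1
    have hr0 : 0 < r := by linarith
    -- If `r > 1` were admissible, `u / r` would be a bound smaller than the infimum `u`.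
    have : u / r ∈ A := ⟨by positivity, fun x => by
      have := hr x
      rw [Pi.smul_apply, smul_eq_mul, abs_mul, abs_of_pos (inv_pos.2 hupos)] at this
      rw [div_mul_eq_mul_div, le_div_iff₀ hr0]
      calc |χ x| * r = u * (r * (u⁻¹ * |χ x|)) := by field_simp
        _ ≤ u * ‖x‖ := by gcongr⟩
    have h2 := csInf_le hAb this
    have h3 : u / r < u := div_lt_self hupos h1
    exact absurd h2 (not_le.2 h3)

section
variable [IsOrderedAddMonoid X] [IsOrderedModule ℝ X]

/-- Distinct elements of the sphere lie on distinct rays, so `D` itself approximates `φ` from off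
its ray at the maximal height 1. -/
lemma accumHeight_eq_one_of_mem_closure {D : Set (X → ℝ)} (hD : D ⊆ homSphere X) {φ : X → ℝ}
    (hφ : φ ∈ homSphere X) (hφD : φ ∉ D) (hcl : φ ∈ closure D) : accumHeight φ = 1 := by
  have hsub : D ⊆ offRay (normSeminorm ℝ X) φ := fun ψ hψ => ⟨(hD hψ).1, fun r hr => hφD
    (homSphere_eq_of_eq_smul hφ (hD hψ) hr ▸ hψ)⟩
  have h1 : (1 : ℝ) ∈ accum (normSeminorm ℝ X) φ :=
    ⟨one_pos, (one_smul ℝ φ).symm ▸ closure_mono hsub hcl⟩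
  exact le_antisymm (csSup_le ⟨1, h1⟩ fun _ => le_one_of_mem_accum hφ)
    (le_csSup (bddAbove_accum hφ) h1)

/-- `a` is a positive element with `φ a = 1` on which all lattice homomorphisms outside the
line through `φ` vanish. -/
structure IsPeakAtom (φ : X → ℝ) (a : X) : Prop where
  nonneg : 0 ≤ a
  apply_self : φ a = 1
  apply_of_ne : ∀ ψ ∈ homBall (normSeminorm ℝ X), (∀ r : ℝ, ψ ≠ r • φ) → ψ a = 0

/-- No positive multiple of `φ` lies in the compact set `closure (offRay _ φ)`, so each of its
points is separated from `φ` by a positive vector. Finitely many such vectors suffice, and their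
infimum works because lattice homomorphisms preserve infima. -/
lemma exists_lt_on_closure_offRay {φ : X → ℝ} (hφ : φ ∈ homSphere X)
    (h : accum (normSeminorm ℝ X) φ = ∅) {δ : ℝ} (hδ : 0 < δ) :
    ∃ x, 0 ≤ x ∧ φ x = 1 ∧ ∀ ψ ∈ closure (offRay (normSeminorm ℝ X) φ), ψ x < δ := by
  set C := closure (offRay (normSeminorm ℝ X) φ)
  have hC : IsCompact C :=
    (isCompact_homBall _).of_isClosed_subset isClosed_closure (closure_offRay_subset _ _)
  have hom : ∀ ψ ∈ C, IsRealLatticeHom ψ := fun ψ hψ => (closure_offRay_subset _ _ hψ).1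
  have h0 := homSphere_ne_zero hφ
  have := hC.induction_on (p := fun s => ∃ x, 0 ≤ x ∧ φ x = 1 ∧ ∀ ψ ∈ s ∩ C, ψ x < δ) ?_ ?_ ?_ ?_
  · simpa using this
  · obtain ⟨x, hx, hx1⟩ := hφ.1.1.exists_nonneg_eq_one h0
    exact ⟨x, hx, hx1, by simp⟩
  · rintro s t hst ⟨x, hx, hx1, hxt⟩
    exact ⟨x, hx, hx1, fun ψ hψ => hxt ψ ⟨hst hψ.1, hψ.2⟩⟩
  · rintro s t ⟨x, hx, hx1, hxs⟩ ⟨y, hy, hy1, hyt⟩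
    refine ⟨x ⊓ y, le_inf hx hy, by rw [hφ.1.1.inf, hx1, hy1, min_self], ?_⟩
    rintro ψ ⟨hψ | hψ, hψC⟩
    · exact ((hom ψ hψC).mono inf_le_left).trans_lt (hxs ψ ⟨hψ, hψC⟩)
    · exact ((hom ψ hψC).mono inf_le_right).trans_lt (hyt ψ ⟨hψ, hψC⟩)
  · intro ψ hψ
    obtain ⟨x, hx, hx1, hx0⟩ := hφ.1.1.exists_separating (hom ψ hψ) h0 (fun r hr hψr => by
      have : r ∈ accum (normSeminorm ℝ X) φ := ⟨hr, hψr ▸ hψ⟩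
      simp [h] at this)
    refine ⟨{χ | χ x < δ}, mem_nhdsWithin_of_mem_nhds ?_, x, hx, hx1, fun χ hχ => hχ.1⟩
    exact (isOpen_lt (continuous_apply x) continuous_const).mem_nhds (by simpa [hx0] using hδ)

variable [HasSolidNorm X] [CompleteSpace X]

/-- A ray that is not approximated by other rays is the coordinate functional of an atom. -/
theorem exists_isPeakAtom (hX : IsAMNorm (normSeminorm ℝ X)) {φ : X → ℝ} (hφ : φ ∈ homSphere X)
    (hm : accumHeight φ = 0) : ∃ a, IsPeakAtom φ a := by
  have hempty : accum (normSeminorm ℝ X) φ = ∅ := by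
    by_contra hne
    obtain ⟨t, ht⟩ := nonempty_iff_ne_empty.2 hne
    have := le_csSup (bddAbove_accum hφ) ht
    have h2 : t ≤ 0 := hm ▸ this
    exact absurd ht.1 (not_lt.2 h2)
  choose x hx0 hx1 hx using fun n : ℕ =>
    exists_lt_on_closure_offRay hφ hempty (Nat.one_div_pos_of_nat (α := ℝ) (n := n))
  have hcauchy : CauchySeq x := by
    refine cauchySeq_of_le_tendsto_0 (fun n : ℕ => 1 / ((n : ℝ) + 1)) ?_
      tendsto_one_div_add_atTop_nhds_zero_nat
    intro n m k hn hm
    rw [dist_eq_norm]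
    -- The difference is normed by some `χ`. On the line of `φ` both vectors take the same value;
    -- off it both values lie in `[0, 1 / (k + 1)]`.
    rcases eq_or_ne (x n - x m) 0 with h | h
    · rw [h, norm_zero]; positivity
    obtain ⟨χ, hχ, hχn⟩ := exists_homSphere_abs_eq_norm hX h
    rw [← hχn, hχ.1.1.sub]
    by_cases hr : ∀ r : ℝ, χ ≠ r • φ
    · have hmem := subset_closure (show χ ∈ offRay (normSeminorm ℝ X) φ from ⟨hχ.1, hr⟩)
      have a1 := hx n χ hmem
      have a2 := hx m χ hmem
      have a3 := hχ.1.1.nonneg (hx0 n)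
      have a4 := hχ.1.1.nonneg (hx0 m)
      have b1 : 1 / ((n : ℝ) + 1) ≤ 1 / ((k : ℝ) + 1) := Nat.one_div_le_one_div hn
      have b2 : 1 / ((m : ℝ) + 1) ≤ 1 / ((k : ℝ) + 1) := Nat.one_div_le_one_div hm
      rw [abs_le]
      constructor <;> linarith
    · push Not at hr
      obtain ⟨r, rfl⟩ := hr
      simp only [Pi.smul_apply, hx1, sub_self, abs_zero]
      positivity
  obtain ⟨a, ha⟩ := cauchySeq_tendsto_of_complete hcauchy
  have cont : ∀ ψ ∈ homBall (normSeminorm ℝ X), Tendsto (fun n => ψ (x n)) atTop (𝓝 (ψ a)) :=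
    fun ψ hψ => ((IsRealLatticeHom.lipschitzWith hψ).continuous.tendsto a).comp ha
  refine ⟨a, isClosed_nonneg.mem_of_tendsto ha (Eventually.of_forall hx0), ?_, fun ψ hψ hr => ?_⟩
  · have := cont φ hφ.1
    simp only [hx1] at this
    exact (tendsto_nhds_unique this tendsto_const_nhds)
  · have hmem := subset_closure (show ψ ∈ offRay (normSeminorm ℝ X) φ from ⟨hψ, hr⟩)
    refine tendsto_nhds_unique (cont ψ hψ) (squeeze_zero (fun n => hψ.1.nonneg (hx0 n))
      (fun n => (hx n ψ hmem).le) tendsto_one_div_add_atTop_nhds_zero_nat)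

/-- Homomorphisms of norm one separate points: off the line of `φ` they vanish on `a`, hence on `[0,
a]`, and on that line `x` and `φ x • a` agree. -/
lemma IsPeakAtom.isLatticeAtom (hX : IsAMNorm (normSeminorm ℝ X)) {φ : X → ℝ}
    (hφ : φ ∈ homSphere X) {a : X} (ha : IsPeakAtom φ a) : IsLatticeAtom a := by
  refine ⟨lt_of_le_of_ne ha.nonneg ?_, fun x hx hxa => ⟨φ x, eq_of_forall_homSphere hX ?_⟩⟩
  · rintro rfl
    have := ha.apply_self
    rw [hφ.1.1.zero] at this
    exact zero_ne_one this
  · intro ψ hψ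
    rw [hψ.1.1.smul]
    by_cases hr : ∀ r : ℝ, ψ ≠ r • φ
    · have h0 := ha.apply_of_ne ψ hψ.1 hr
      rw [h0, mul_zero]
      exact le_antisymm (h0 ▸ hψ.1.1.mono hxa) (hψ.1.1.nonneg hx)
    · push Not at hr
      obtain ⟨r, rfl⟩ := hr
      simp only [Pi.smul_apply, smul_eq_mul, ha.apply_self]
      ring

end

end Accumulation

/-! ### Invariants of rays under lattice isometries -/

section Gauge

variable {X : Type*} [NormedAddCommGroup X] [NormedSpace ℝ X] [Lattice X]

/-- `N` is an equivalent norm for which the functional `φ` of original norm one has norm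
`(1 + ε φ)⁻¹`, and only finitely many of the numbers `ε φ` exceed any given bound. -/
structure IsGaugedBy (N : Seminorm ℝ X) (ε : (X → ℝ) → ℝ) (c : ℝ) : Prop where
  norm_le : ∀ x, ‖x‖ ≤ N x
  le_mul_norm : ∀ x, N x ≤ c * ‖x‖
  gauge : ∀ φ ∈ homSphere X, ∀ r : ℝ, (∀ x, r * |φ x| ≤ N x) ↔ r ≤ 1 + ε φ
  nonneg : ∀ φ ∈ homSphere X, 0 ≤ ε φ
  finite : ∀ δ : ℝ, 0 < δ → {φ ∈ homSphere X | δ < ε φ}.Finite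

variable {N : Seminorm ℝ X} {ε : (X → ℝ) → ℝ} {c : ℝ}

/-- For given `δ`, all but finitely many rays fit into the old ball after shrinking by `(1 + δ)⁻¹`.
The finitely many exceptional rays other than that of `φ` form a closed set of segments missing `t •
φ`. Then `δ → 0`. -/
lemma IsGaugedBy.closure_offRay (h : IsGaugedBy N ε c) {φ : X → ℝ} (hφ : φ ∈ homSphere X) {t : ℝ}
    (ht : 0 < t) (htφ : t • φ ∈ closure (offRay N φ)) :
    t • φ ∈ closure (offRay (normSeminorm ℝ X) φ) := by
  set C := closure (offRay (normSeminorm ℝ X) φ)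
  have approx : ∀ δ : ℝ, 0 < δ → (1 + δ)⁻¹ • t • φ ∈ C := by
    intro δ hδ
    set F := {d ∈ homSphere X | δ < ε d} ∩ {d | ∀ r : ℝ, d ≠ r • φ}
    have hF : F.Finite := (h.finite δ hδ).inter_of_left _
    set K : Set (X → ℝ) := ⋃ d ∈ F, (fun r : ℝ => r • d) '' Icc 0 (1 + ε d)
    have hK : IsClosed K := (hF.isCompact_biUnion fun d _ =>
      isCompact_Icc.image (by fun_prop)).isClosed
    have hP : IsClosed ((fun χ : X → ℝ => (1 + δ)⁻¹ • χ) ⁻¹' C) :=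
      isClosed_closure.preimage (by fun_prop)
    have hsub : offRay N φ ⊆ K ∪ (fun χ : X → ℝ => (1 + δ)⁻¹ • χ) ⁻¹' C := by
      rintro ψ ⟨hψ, hψφ⟩
      have hψ0 : ψ ≠ 0 := fun h0 => hψφ 0 (by simp [h0])
      obtain ⟨u, hu, χ, hχ, rfl⟩ := exists_homSphere_smul hψ.1 hψ0
        fun x => (hψ.2 x).trans (h.le_mul_norm x)
      have hχφ : ∀ r : ℝ, χ ≠ r • φ := fun r hr => hψφ (u * r) (by rw [hr, smul_smul])
      have hu1 : u ≤ 1 + ε χ := (h.gauge χ hχ u).1 fun x => by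
        have := hψ.2 x
        rwa [Pi.smul_apply, smul_eq_mul, abs_mul, abs_of_pos hu] at this
      rcases lt_or_ge δ (ε χ) with hlt | hge
      · exact Or.inl (mem_biUnion (show χ ∈ F from ⟨⟨hχ, hlt⟩, hχφ⟩) ⟨u, ⟨hu.le, hu1⟩, rfl⟩)
      · refine Or.inr (subset_closure ?_)
        have hv : 0 ≤ (1 + δ)⁻¹ * u := by positivity
        have hv1 : (1 + δ)⁻¹ * u ≤ 1 := by
          rw [inv_mul_le_iff₀ (by positivity)]
          linarith
        simp only [smul_smul]
        refine ⟨⟨hχ.1.1.const_smul hv, fun x => ?_⟩, fun r hr => hχφ (((1 + δ)⁻¹ * u)⁻¹ * r) ?_⟩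
        · rw [Pi.smul_apply, smul_eq_mul, abs_mul, abs_of_nonneg hv]
          exact (mul_le_of_le_one_left (abs_nonneg _) hv1).trans (hχ.1.2 x)
        · rw [← smul_smul, ← hr, inv_smul_smul₀ (by positivity)]
    rcases closure_minimal hsub (hK.union hP) htφ with hmem | hmem
    · obtain ⟨d, hd, r, -, hr⟩ := mem_iUnion₂.1 hmem
      simp only at hr
      have hr0 : r ≠ 0 := by
        rintro rfl
        rw [zero_smul] at hr
        exact (smul_ne_zero ht.ne' (homSphere_ne_zero hφ)) hr.symm
      exact absurd (by rw [← smul_smul, ← hr, inv_smul_smul₀ hr0]) (hd.2 (r⁻¹ * t))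
    · exact hmem
  have hlim : Tendsto (fun n : ℕ => (1 + 1 / ((n : ℝ) + 1))⁻¹ • t • φ) atTop (𝓝 (t • φ)) := by
    have h1 : Tendsto (fun n : ℕ => (1 + 1 / ((n : ℝ) + 1))⁻¹) atTop (𝓝 (1 + 0)⁻¹) :=
      (tendsto_one_div_add_atTop_nhds_zero_nat.const_add 1).inv₀ (by norm_num)
    have h2 := h1.smul_const (t • φ)
    simpa using h2
  exact isClosed_closure.mem_of_tendsto hlim (Eventually.of_forall fun n => approx _ (by positivity))

lemma IsGaugedBy.accum_eq (h : IsGaugedBy N ε c) {φ : X → ℝ} (hφ : φ ∈ homSphere X) :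
    accum N φ = accum (normSeminorm ℝ X) φ := by
  ext t
  have hsub : offRay (normSeminorm ℝ X) φ ⊆ offRay N φ := fun ψ hψ =>
    ⟨⟨hψ.1.1, fun x => (hψ.1.2 x).trans (h.norm_le x)⟩, hψ.2⟩
  exact ⟨fun ht => ⟨ht.1, h.closure_offRay hφ ht.1 ht.2⟩,
    fun ht => ⟨ht.1, closure_mono hsub ht.2⟩⟩

lemma comp_mem_homBall {T : X →ₗ[ℝ] X} (hT : IsLatticeIsometry N T) {φ : X → ℝ}
    (hφ : φ ∈ homBall N) : φ ∘ T ∈ homBall N :=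
  ⟨hφ.1.comp hT, fun x => (hφ.2 (T x)).trans_eq (hT.isometry x)⟩

/-- Lattice isometries are invertible. -/
lemma IsLatticeIsometry.exists_inverse (hN : ∀ x, N x = 0 → x = 0) {T : X →ₗ[ℝ] X}
    (hT : IsLatticeIsometry N T) :
    ∃ S : X →ₗ[ℝ] X, IsLatticeIsometry N S ∧ ∀ x, T (S x) = x := by
  have hinj : Function.Injective T := by
    rw [← LinearMap.ker_eq_bot, LinearMap.ker_eq_bot']
    intro x hx
    exact hN x (by rw [← hT.isometry, hx, map_zero])
  let e := LinearEquiv.ofBijective T ⟨hinj, hT.surjective⟩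
  have he : ∀ x, T (e.symm x) = x := fun x => e.apply_symm_apply x
  refine ⟨e.symm.toLinearMap, ⟨e.symm.surjective, fun x y => hinj ?_, fun x y => hinj ?_,
    fun x => ?_⟩, he⟩
  · simp only [LinearEquiv.coe_coe, he, hT.map_sup]
  · simp only [LinearEquiv.coe_coe, he, hT.map_inf]
  · rw [LinearEquiv.coe_coe, ← hT.isometry, he]

lemma mul_mem_accum {T : X →ₗ[ℝ] X} (hT : IsLatticeIsometry N T) {φ ψ : X → ℝ} {u : ℝ} (hu : 0 < u)
    (h : φ ∘ T = u • ψ) {t : ℝ} (ht : t ∈ accum N φ) : u * t ∈ accum N ψ := by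
  refine ⟨mul_pos hu ht.1, ?_⟩
  have hcont : Continuous fun χ : X → ℝ => χ ∘ T :=
    continuous_pi fun x => continuous_apply (T x)
  have hmaps : MapsTo (fun χ : X → ℝ => χ ∘ T) (offRay N φ) (offRay N ψ) := by
    rintro χ ⟨hχ, hχφ⟩
    refine ⟨comp_mem_homBall hT hχ, fun r hr => hχφ (r * u⁻¹) ?_⟩
    apply hT.surjective.injective_comp_right
    simp only at hr ⊢
    rw [hr]
    funext x
    have := congrFun h x
    simp only [Function.comp_apply, Pi.smul_apply, smul_eq_mul] at this ⊢
    rw [this]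
    field_simp
  have := map_mem_closure hcont ht.2 hmaps
  convert this using 1
  funext x
  have := congrFun h x
  simp only [Function.comp_apply, Pi.smul_apply, smul_eq_mul] at this ⊢
  rw [this]
  ring

lemma IsGaugedBy.mul_le_and_mul_le (h : IsGaugedBy N ε c) {T : X →ₗ[ℝ] X}
    (hT : IsLatticeIsometry N T) {φ ψ : X → ℝ} (hφ : φ ∈ homSphere X) (hψ : ψ ∈ homSphere X)
    {u : ℝ} (hu : 0 < u) (hφψ : φ ∘ T = u • ψ) :
    u * (1 + ε φ) ≤ 1 + ε ψ ∧ u * accumHeight φ ≤ accumHeight ψ := by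
  constructor
  · refine (h.gauge ψ hψ _).1 fun x => ?_
    have h1 := (h.gauge φ hφ (1 + ε φ)).2 le_rfl (T x)
    have h2 := congrFun hφψ x
    simp only [Function.comp_apply, Pi.smul_apply, smul_eq_mul] at h2
    rw [hT.isometry, h2, abs_mul, abs_of_pos hu] at h1
    linarith
  · rw [mul_comm, ← le_div_iff₀ hu]
    refine Real.sSup_le (fun t ht => ?_) (div_nonneg (accumHeight_nonneg ψ) hu.le)
    rw [← h.accum_eq hφ] at ht
    rw [le_div_iff₀ hu, mul_comm]
    refine le_csSup (bddAbove_accum hψ) ?_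
    rw [← h.accum_eq hψ]
    exact mul_mem_accum hT hu hφψ ht

/-- The adjoint of a lattice isometry permutes the rays of lattice homomorphisms, preserving
heights relative to the new norm. -/
lemma IsGaugedBy.exists_comp_eq_smul (h : IsGaugedBy N ε c) {T : X →ₗ[ℝ] X}
    (hT : IsLatticeIsometry N T) {φ : X → ℝ} (hφ : φ ∈ homSphere X) :
    ∃ ψ ∈ homSphere X, ∃ u : ℝ, 0 < u ∧ φ ∘ T = u • ψ ∧ u * (1 + ε φ) = 1 + ε ψ ∧
      u * accumHeight φ = accumHeight ψ := by
  have hN : ∀ x, N x = 0 → x = 0 := fun x hx =>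
    norm_eq_zero.1 (le_antisymm (hx ▸ h.norm_le x) (norm_nonneg x))
  have hφT := comp_mem_homBall hT
    (show φ ∈ homBall N from ⟨hφ.1.1, fun x => (hφ.1.2 x).trans (h.norm_le x)⟩)
  have hφT0 : φ ∘ T ≠ 0 := fun h0 => homSphere_ne_zero hφ (by
    funext x
    obtain ⟨y, rfl⟩ := hT.surjective x
    exact congrFun h0 y)
  obtain ⟨u, hu, ψ, hψ, hφψ⟩ := exists_homSphere_smul hφT.1 hφT0
    fun x => (hφT.2 x).trans (h.le_mul_norm x)
  -- The inverse isometry supplies the reverse inequalities.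
  obtain ⟨S, hS, hTS⟩ := hT.exists_inverse hN
  have hψφ : ψ ∘ S = u⁻¹ • φ := by
    funext x
    have := congrFun hφψ (S x)
    simp only [Function.comp_apply, Pi.smul_apply, smul_eq_mul, hTS] at this ⊢
    rw [this, inv_mul_cancel_left₀ hu.ne']
  obtain ⟨a1, a2⟩ := h.mul_le_and_mul_le hT hφ hψ hu hφψ
  obtain ⟨b1, b2⟩ := h.mul_le_and_mul_le hS hψ hφ (inv_pos.2 hu) hψφ
  rw [inv_mul_le_iff₀ hu] at b1 b2
  exact ⟨ψ, hψ, u, hu, hφψ, le_antisymm a1 b1, le_antisymm a2 b2⟩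

variable [IsOrderedAddMonoid X] [IsOrderedModule ℝ X]

/-- Sufficient conditions on the perturbation `ε`, supported on a dense set `D`, for rigidity at
the functionals that are approximated by other rays. -/
structure IsRigidPerturbation (D : Set (X → ℝ)) (ε : (X → ℝ) → ℝ) : Prop where
  subset : D ⊆ homSphere X
  dense : homSphere X ⊆ closure D
  pos : ∀ φ ∈ D, 0 < ε φ
  eq_zero : ∀ φ ∉ D, ε φ = 0
  inj : ∀ φ ∈ D, ∀ ψ ∈ D, accumHeight φ / (1 + ε φ) = accumHeight ψ / (1 + ε ψ) →
    accumHeight φ ≠ 0 → φ = ψ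
  inj_zero : ∀ φ ∈ D, ∀ ψ ∈ D, accumHeight φ = 0 → accumHeight ψ = 0 → ε φ = ε ψ → φ = ψ

/-- The ratio `accumHeight / (1 + ε)` is invariant. It would be 1 at `ψ ∉ D`, by density of `D`, but
at `φ ∈ D` it is less than 1 because `accumHeight φ ≤ 1` and `ε φ > 0`. -/
lemma IsRigidPerturbation.comp_eq {D : Set (X → ℝ)} (hε : IsRigidPerturbation D ε) (h : IsGaugedBy N ε c)
    {T : X →ₗ[ℝ] X} (hT : IsLatticeIsometry N T) {φ : X → ℝ} (hφ : φ ∈ D) :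
    ∃ ψ ∈ D, ∃ u : ℝ, 0 < u ∧ φ ∘ T = u • ψ ∧ u * (1 + ε φ) = 1 + ε ψ ∧
      (accumHeight φ ≠ 0 → φ = ψ) ∧ (accumHeight φ = 0 → accumHeight ψ = 0) := by
  obtain ⟨ψ, hψ, u, hu, hφψ, h1, h2⟩ := h.exists_comp_eq_smul hT (hε.subset hφ)
  have e1 := hε.pos φ hφ
  have e2 := h.nonneg ψ hψ
  have hratio : accumHeight φ / (1 + ε φ) = accumHeight ψ / (1 + ε ψ) := by
    rw [← h1, ← h2, mul_div_mul_left _ _ hu.ne']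
  have hψD : ψ ∈ D := by
    by_contra hn
    have m1 := accumHeight_eq_one_of_mem_closure hε.subset hψ hn (hε.dense hψ)
    rw [m1, hε.eq_zero ψ hn, add_zero, div_one, div_eq_one_iff_eq (by positivity)] at hratio
    have : accumHeight φ ≤ 1 :=
      Real.sSup_le (fun t => le_one_of_mem_accum (hε.subset hφ)) zero_le_one
    linarith
  exact ⟨ψ, hψD, u, hu, hφψ, h1, hε.inj φ hφ ψ hψD hratio, fun h0 => by rw [← h2, h0, mul_zero]⟩

/-- A lattice isometry whose adjoint fixes the rays of a dense set of functionals is trivial. -/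
lemma eq_id_of_comp_eq [HasSolidNorm X] (hX : IsAMNorm (normSeminorm ℝ X)) {D : Set (X → ℝ)}
    (hD : homSphere X ⊆ closure D) {T : X →ₗ[ℝ] X} (h : ∀ φ ∈ D, φ ∘ T = φ) :
    T = LinearMap.id := by
  ext x
  refine eq_of_forall_homSphere hX fun φ hφ => ?_
  have hcl : IsClosed {χ : X → ℝ | χ (T x) = χ x} :=
    isClosed_eq (continuous_apply _) (continuous_apply _)
  exact closure_minimal (fun χ hχ => congrFun (h χ hχ) x) hcl (hD hφ)

lemma isLatticeIsometry_id (N : Seminorm ℝ X) : IsLatticeIsometry N LinearMap.id :=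
  ⟨Function.surjective_id, fun _ _ => rfl, fun _ _ => rfl, fun _ => rfl⟩

end Gauge

/-! ### Choice of weights and the weighted sum norm -/

section Perturbation

lemma exists_seq_pos_le_pairwise_ne (G : ℕ → ℝ → ℝ) (hG : ∀ n, InjOn (G n) (Ioi 0)) (b : ℕ → ℝ)
    (hb : ∀ n, 0 < b n) :
    ∃ e : ℕ → ℝ, (∀ n, 0 < e n ∧ e n ≤ b n) ∧ ∀ n m, G n (e n) = G m (e m) → n = m := by
  classical
  have hstep : ∀ n (s : Finset ℝ), ∃ x : ℝ, (0 < x ∧ x ≤ b n) ∧ G n x ∉ s := by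
    intro n s
    have hinf : (G n '' Ioc 0 (b n)).Infinite :=
      (Ioc_infinite (hb n)).image ((hG n).mono fun x hx => hx.1)
    obtain ⟨_, ⟨x, hx, rfl⟩, hxs⟩ := hinf.exists_notMem_finset s
    exact ⟨x, hx, hxs⟩
  choose x hx hxs using hstep
  -- Greedy choice: `s n` collects the values already used, and an injective image of an interval is
  -- too large to be exhausted by them.
  let s : ℕ → Finset ℝ := fun n => Nat.rec ∅ (fun k t => insert (G k (x k t)) t) n
  have hs : ∀ n, s (n + 1) = insert (G n (x n (s n))) (s n) := fun n => rfl
  have hmono : Monotone s := monotone_nat_of_le_succ fun n => by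
    rw [hs]; exact Finset.subset_insert _ _
  have hne : ∀ n m, n < m → G n (x n (s n)) ≠ G m (x m (s m)) := fun n m hnm h => by
    refine hxs m (s m) (hmono (show n + 1 ≤ m from hnm) ?_)
    rw [← h, hs]
    exact Finset.mem_insert_self _ _
  refine ⟨fun n => x n (s n), fun n => hx n _, fun n m h => ?_⟩
  rcases lt_trichotomy n m with hlt | heq | hlt
  · exact absurd h (hne n m hlt)
  · exact heq
  · exact absurd h.symm (hne m n hlt)

lemma exists_summable_perturbation {α : Type*} [Nonempty α] {D : Set α} (hD : D.Countable)
    (g : α → ℝ → ℝ) (hg : ∀ a, InjOn (g a) (Ioi 0)) {η : ℝ} (hη : 0 < η) :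
    ∃ ε : α → ℝ, (∀ a ∈ D, 0 < ε a) ∧ (∀ a ∉ D, ε a = 0) ∧ Summable ε ∧ ∑' a, ε a ≤ η ∧
      ∀ a ∈ D, ∀ b ∈ D, g a (ε a) = g b (ε b) → a = b := by
  classical
  obtain ⟨f, hf⟩ := countable_iff_exists_injOn.1 hD
  obtain ⟨e, he, hne⟩ := exists_seq_pos_le_pairwise_ne (fun n => g (Function.invFunOn f D n))
    (fun n => hg _) (fun n => η / 2 / 2 ^ n) (fun n => by positivity)
  have hinv : ∀ a ∈ D, Function.invFunOn f D (f a) = a := fun a ha => hf.leftInvOn_invFunOn ha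
  have hse : Summable e := Summable.of_nonneg_of_le (fun n => (he n).1.le) (fun n => (he n).2)
    (summable_geometric_two' η)
  have hinj : Function.Injective fun d : D => f d := hf.injective
  refine ⟨D.indicator (e ∘ f), fun a ha => ?_, fun a ha => indicator_of_notMem ha _, ?_, ?_, ?_⟩
  · rw [indicator_of_mem ha]; exact (he _).1
  · rw [← summable_subtype_iff_indicator]
    exact hse.comp_injective hinj
  · rw [← tsum_subtype D (e ∘ f)]
    calc ∑' d : D, e (f d) ≤ ∑' n, e n :=
          tsum_comp_le_tsum_of_inj hse (fun n => (he n).1.le) hinj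
      _ ≤ ∑' n : ℕ, η / 2 / 2 ^ n := hse.tsum_le_tsum (fun n => (he n).2) (summable_geometric_two' η)
      _ = η := tsum_geometric_two' η
  · intro a ha b hb hab
    rw [indicator_of_mem ha, indicator_of_mem hb] at hab
    refine hf ha hb (hne _ _ ?_)
    simp only [hinv a ha, hinv b hb]
    exact hab

variable {X : Type*} [NormedAddCommGroup X] [NormedSpace ℝ X] [Lattice X]

lemma exists_isRigidPerturbation [TopologicalSpace.SeparableSpace X] {η : ℝ} (hη : 0 < η) :
    ∃ (D : Set (X → ℝ)) (ε : (X → ℝ) → ℝ),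
      IsRigidPerturbation D ε ∧ Summable ε ∧ ∑' φ, ε φ ≤ η := by
  classical
  obtain ⟨D, hDS, hDc, hD⟩ := exists_countable_subset_closure (homSphere X)
    fun φ hφ => IsRealLatticeHom.lipschitzWith hφ.1
  obtain ⟨ε, h1, h2, h3, h4, h5⟩ := exists_summable_perturbation hDc
    -- The ratio carries no information at height zero, so there the weights themselves are made
    -- distinct. The sign is immaterial: only injectivity in `t` matters.
    (fun φ t => if accumHeight φ = 0 then -t else accumHeight φ / (1 + t)) (fun φ s hs t ht h => by
      simp only [mem_Ioi] at hs ht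
      by_cases h0 : accumHeight φ = 0
      · simpa [h0] using h
      · simp only [h0, if_false] at h
        rw [div_eq_div_iff (by positivity) (by positivity)] at h
        have := mul_left_cancel₀ h0 h
        linarith) hη
  refine ⟨D, ε, ⟨hDS, hD, h1, h2, fun φ hφ ψ hψ h h0 => h5 φ hφ ψ hψ ?_,
    fun φ hφ ψ hψ hφ0 hψ0 h => h5 φ hφ ψ hψ ?_⟩, h3, h4⟩
  · have hψ0 : accumHeight ψ ≠ 0 := by
      intro hψ0
      rw [hψ0, zero_div, div_eq_zero_iff] at h
      have := h1 φ hφ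
      exact h.elim h0 (by positivity)
    simpa only [h0, hψ0, if_false] using h
  · simp only [hφ0, hψ0, if_true, h]

section
variable [IsOrderedAddMonoid X] [IsOrderedModule ℝ X] [HasSolidNorm X]

/-- Almost norming vectors for a functional that vanish at finitely many others. -/
lemma exists_almost_norming {φ : X → ℝ} (hφ : φ ∈ homSphere X) {δ : ℝ} (hδ : 0 < δ)
    (F : Finset (X → ℝ)) :
    ∃ x, 0 ≤ x ∧ φ x = 1 ∧ ‖x‖ ≤ 1 + δ ∧ ∀ ψ ∈ F, ψ ∈ homSphere X → ψ ≠ φ → ψ x = 0 := by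
  classical
  induction F using Finset.induction_on with
  | empty =>
    -- Since `φ` has norm one, the factor `1 + δ > 1` is not admissible.
    have : ¬ ∀ x, (1 + δ) * |φ x| ≤ ‖x‖ := fun h => by
      have := hφ.2 _ h
      linarith
    push Not at this
    obtain ⟨x, hx⟩ := this
    have hpos : 0 < |φ x| := by
      by_contra! h
      have := norm_nonneg x
      nlinarith [abs_nonneg (φ x)]
    refine ⟨|φ x|⁻¹ • |x|, smul_nonneg (by positivity) (abs_nonneg x), ?_, ?_, by simp⟩
    · rw [hφ.1.1.smul, hφ.1.1.abs, inv_mul_cancel₀ hpos.ne']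
    · rw [norm_smul, norm_abs_eq_norm, Real.norm_of_nonneg (by positivity), inv_mul_le_iff₀ hpos]
      linarith
  | insert ψ F _ ih =>
    obtain ⟨x, hx, hx1, hxn, hxF⟩ := ih
    by_cases hψ : ψ ∈ homSphere X ∧ ψ ≠ φ
    · obtain ⟨y, hy, hy1, hy0⟩ := hφ.1.1.exists_separating hψ.1.1.1 (homSphere_ne_zero hφ)
        fun r hr h => hψ.2 (homSphere_eq_of_smul hψ.1 hφ hr.le h)
      refine ⟨x ⊓ y, le_inf hx hy, by rw [hφ.1.1.inf, hx1, hy1, min_self],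
        (norm_le_norm_of_nonneg_of_le (le_inf hx hy) inf_le_left).trans hxn, fun χ hχ hχS hχφ => ?_⟩
      rw [hχS.1.1.inf]
      rcases Finset.mem_insert.1 hχ with rfl | hχF
      · rw [hy0, min_eq_right (hχS.1.1.nonneg hx)]
      · rw [hxF χ hχF hχS hχφ, min_eq_left (hχS.1.1.nonneg hy)]
    · refine ⟨x, hx, hx1, hxn, fun χ hχ hχS hχφ => ?_⟩
      rcases Finset.mem_insert.1 hχ with rfl | hχF
      · exact absurd ⟨hχS, hχφ⟩ hψ
      · exact hxF χ hχF hχS hχφ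

end

variable {D : Set (X → ℝ)} {ε : (X → ℝ) → ℝ}

lemma IsRigidPerturbation.nonneg (hε : IsRigidPerturbation D ε) (φ : X → ℝ) : 0 ≤ ε φ := by
  by_cases h : φ ∈ D
  · exact (hε.pos φ h).le
  · exact (hε.eq_zero φ h).ge

lemma IsRigidPerturbation.mul_abs_le (hε : IsRigidPerturbation D ε) (φ : X → ℝ) (x : X) :
    ε φ * |φ x| ≤ ε φ * ‖x‖ := by
  by_cases h : φ ∈ D
  · exact mul_le_mul_of_nonneg_left ((hε.subset h).1.2 x) (hε.nonneg φ)
  · simp [hε.eq_zero φ h]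

lemma IsRigidPerturbation.summable_mul_abs (hε : IsRigidPerturbation D ε) (hs : Summable ε)
    (x : X) : Summable fun φ => ε φ * |φ x| :=
  Summable.of_nonneg_of_le (fun φ => mul_nonneg (hε.nonneg φ) (abs_nonneg _))
    (fun φ => hε.mul_abs_le φ x) (hs.mul_right ‖x‖)

/-- The perturbation of the norm by a weighted sum of lattice homomorphisms. -/
noncomputable def sumSeminorm (hε : IsRigidPerturbation D ε) (hs : Summable ε) : Seminorm ℝ X :=
  Seminorm.of (fun x => ‖x‖ + ∑' φ, ε φ * |φ x|)
    (fun x y => by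
      have h : ∑' φ, ε φ * |φ (x + y)| ≤ ∑' φ, (ε φ * |φ x| + ε φ * |φ y|) := by
        refine (hε.summable_mul_abs hs _).tsum_le_tsum (fun φ => ?_)
          ((hε.summable_mul_abs hs x).add (hε.summable_mul_abs hs y))
        by_cases h : φ ∈ D
        · rw [← mul_add, (hε.subset h).1.1.add]
          exact mul_le_mul_of_nonneg_left (abs_add_le _ _) (hε.nonneg φ)
        · simp [hε.eq_zero φ h]
      rw [(hε.summable_mul_abs hs x).tsum_add (hε.summable_mul_abs hs y)] at h
      linarith [norm_add_le x y])
    (fun r x => by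
      rw [norm_smul, mul_add, ← tsum_mul_left]
      congr 2
      funext φ
      by_cases h : φ ∈ D
      · rw [(hε.subset h).1.1.smul, abs_mul, Real.norm_eq_abs]; ring
      · simp [hε.eq_zero φ h])

lemma sumSeminorm_apply (hε : IsRigidPerturbation D ε) (hs : Summable ε) (x : X) :
    sumSeminorm hε hs x = ‖x‖ + ∑' φ, ε φ * |φ x| := rfl

lemma one_add_mul_abs_le_sumSeminorm (hε : IsRigidPerturbation D ε) (hs : Summable ε) {φ : X → ℝ}
    (hφ : φ ∈ homSphere X) (x : X) : (1 + ε φ) * |φ x| ≤ sumSeminorm hε hs x := by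
  have h1 := (hε.summable_mul_abs hs x).le_tsum φ
    fun ψ _ => mul_nonneg (hε.nonneg ψ) (abs_nonneg _)
  have h2 := hφ.1.2 x
  rw [coe_normSeminorm] at h2
  rw [sumSeminorm_apply]
  linarith

lemma sumSeminorm_le (hε : IsRigidPerturbation D ε) (hs : Summable ε) (x : X) :
    sumSeminorm hε hs x ≤ (1 + ∑' φ, ε φ) * ‖x‖ := by
  rw [sumSeminorm_apply, add_mul, one_mul, ← tsum_mul_right]
  exact add_le_add_right ((hε.summable_mul_abs hs x).tsum_le_tsum (fun φ => hε.mul_abs_le φ x)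
    (hs.mul_right _)) _

variable [IsOrderedAddMonoid X] [IsOrderedModule ℝ X] [HasSolidNorm X]

lemma norm_le_of_one_add_mul_abs_le (hX : IsAMNorm (normSeminorm ℝ X))
    (hε : IsRigidPerturbation D ε) {N : Seminorm ℝ X}
    (hN : ∀ φ ∈ homSphere X, ∀ x, (1 + ε φ) * |φ x| ≤ N x) (x : X) : ‖x‖ ≤ N x := by
  rcases eq_or_ne x 0 with rfl | hx
  · simp
  · obtain ⟨φ, hφ, hφx⟩ := exists_homSphere_abs_eq_norm hX hx
    rw [← hφx]
    exact (le_mul_of_one_le_left (abs_nonneg _) (by linarith [hε.nonneg φ])).trans (hN φ hφ x)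

/-- An almost norming vector of `φ` can be chosen to vanish on the other functionals in a finite set
carrying all but `δ` of the total weight. In the sum only the term of `φ` and a small tail survive.
-/
lemma le_one_add_of_forall_le_sumSeminorm (hε : IsRigidPerturbation D ε) (hs : Summable ε)
    {φ : X → ℝ} (hφ : φ ∈ homSphere X) {r : ℝ} (hr : ∀ x, r * |φ x| ≤ sumSeminorm hε hs x) :
    r ≤ 1 + ε φ := by
  classical
  have approx : ∀ δ : ℝ, 0 < δ → r ≤ (1 + δ) + (ε φ + (1 + δ) * δ) := by
    intro δ hδ
    obtain ⟨F, hF⟩ := (hs.hasSum.eventually_const_lt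
      (show ∑' φ, ε φ - δ < ∑' φ, ε φ by linarith)).exists
    obtain ⟨x, hx, hx1, hxn, hxF⟩ := exists_almost_norming hφ hδ F
    have h1 := hr x
    rw [hx1, abs_one, mul_one, sumSeminorm_apply] at h1
    -- A summable majorant of `ε ψ * |ψ x|`: the exact term at `φ`, nothing more on `F`, and `(1 +
    -- δ) * ε ψ` off `F`.
    have hsum : HasSum (fun ψ => (if ψ = φ then ε φ else 0) +
        (1 + δ) * (ε ψ - if ψ ∈ F then ε ψ else 0))
        (ε φ + (1 + δ) * (∑' ψ, ε ψ - ∑ ψ ∈ F, ε ψ)) := by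
      refine (hasSum_ite_eq φ (ε φ)).add ((hs.hasSum.sub ?_).mul_left _)
      have : ∑ ψ ∈ F, ε ψ = ∑ ψ ∈ F, if ψ ∈ F then ε ψ else 0 :=
        Finset.sum_congr rfl fun ψ hψ => by rw [if_pos hψ]
      rw [this]
      exact hasSum_sum_of_ne_finset_zero fun ψ hψ => if_neg hψ
    have h2 : ∑' ψ, ε ψ * |ψ x| ≤ ε φ + (1 + δ) * (∑' ψ, ε ψ - ∑ ψ ∈ F, ε ψ) := by
      rw [← hsum.tsum_eq]
      refine (hε.summable_mul_abs hs x).tsum_le_tsum (fun ψ => ?_) hsum.summable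
      have hψ0 := hε.nonneg ψ
      by_cases hψφ : ψ = φ
      · subst hψφ
        rw [hx1, abs_one, if_pos rfl]
        have : 0 ≤ ε ψ - if ψ ∈ F then ε ψ else 0 := by split_ifs <;> linarith
        have := mul_nonneg (show 0 ≤ 1 + δ by positivity) this
        linarith
      rw [if_neg hψφ]
      by_cases hψD : ψ ∈ D
      · by_cases hψF : ψ ∈ F
        · simp [hxF ψ hψF (hε.subset hψD) hψφ, hψF]
        · rw [if_neg hψF, zero_add, sub_zero, mul_comm (1 + δ)]
          exact (hε.mul_abs_le ψ x).trans (mul_le_mul_of_nonneg_left hxn hψ0)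
      · simp [hε.eq_zero ψ hψD]
    have h3 : (1 + δ) * (∑' ψ, ε ψ - ∑ ψ ∈ F, ε ψ) ≤ (1 + δ) * δ :=
      mul_le_mul_of_nonneg_left (by linarith) (by positivity)
    linarith
  have hlim : Tendsto (fun δ : ℝ => (1 + δ) + (ε φ + (1 + δ) * δ)) (𝓝[>] 0) (𝓝 (1 + ε φ)) := by
    have : Continuous fun δ : ℝ => (1 + δ) + (ε φ + (1 + δ) * δ) := by fun_prop
    have h := this.tendsto 0
    simp only [add_zero, mul_zero] at h
    exact h.mono_left nhdsWithin_le_nhds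
  exact ge_of_tendsto hlim (eventually_mem_nhdsWithin.mono fun δ hδ => approx δ hδ)

/-- The lower bound makes every `r ≤ 1 + ε φ` admissible, and the sum norm admits no larger `r`.
This covers the sum norm and the supremum norm at once. -/
lemma isGaugedBy_of_le_sumSeminorm (hX : IsAMNorm (normSeminorm ℝ X))
    (hε : IsRigidPerturbation D ε) (hs : Summable ε) {N : Seminorm ℝ X}
    (hN : ∀ φ ∈ homSphere X, ∀ x, (1 + ε φ) * |φ x| ≤ N x)
    (hN' : ∀ x, N x ≤ sumSeminorm hε hs x) : IsGaugedBy N ε (1 + ∑' φ, ε φ) where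
  norm_le := norm_le_of_one_add_mul_abs_le hX hε hN
  le_mul_norm x := (hN' x).trans (sumSeminorm_le hε hs x)
  gauge φ hφ r := ⟨fun h => le_one_add_of_forall_le_sumSeminorm hε hs hφ fun x =>
      (h x).trans (hN' x),
    fun h x => (mul_le_mul_of_nonneg_right h (abs_nonneg _)).trans (hN φ hφ x)⟩
  nonneg φ _ := hε.nonneg φ
  finite δ hδ := by
    have := (hs.tendsto_cofinite_zero.eventually_lt_const hδ)
    rw [eventually_cofinite] at this
    exact this.subset fun φ hφ => not_lt.2 hφ.2.le

end Perturbation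

/-! ### The weighted supremum norm and rigidity of both norms -/

section Rigidity

variable {X : Type*} [NormedAddCommGroup X] [NormedSpace ℝ X] [Lattice X]
variable {D : Set (X → ℝ)} {ε : (X → ℝ) → ℝ}

lemma bddAbove_one_add_mul_abs (hε : IsRigidPerturbation D ε) (hs : Summable ε) (x : X) :
    BddAbove (range fun φ : homSphere X => (1 + ε φ) * |φ.1 x|) :=
  ⟨sumSeminorm hε hs x, by
    rintro _ ⟨φ, rfl⟩
    exact one_add_mul_abs_le_sumSeminorm hε hs φ.2 x⟩

/-- The perturbation of the norm by a weighted supremum of lattice homomorphisms. -/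
noncomputable def supSeminorm (hε : IsRigidPerturbation D ε) (hs : Summable ε) : Seminorm ℝ X :=
  Seminorm.of (fun x => ⨆ φ : homSphere X, (1 + ε φ) * |φ.1 x|)
    (fun x y => by
      have nonneg : ∀ φ : homSphere X, 0 ≤ 1 + ε φ := fun φ => by linarith [hε.nonneg φ.1]
      refine Real.iSup_le (fun φ => ?_) (add_nonneg
        (Real.iSup_nonneg fun φ => mul_nonneg (nonneg φ) (abs_nonneg _))
        (Real.iSup_nonneg fun φ => mul_nonneg (nonneg φ) (abs_nonneg _)))
      have h1 := le_ciSup (bddAbove_one_add_mul_abs hε hs x) φ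
      have h2 := le_ciSup (bddAbove_one_add_mul_abs hε hs y) φ
      have h3 := mul_le_mul_of_nonneg_left (abs_add_le (φ.1 x) (φ.1 y)) (nonneg φ)
      rw [φ.2.1.1.add]
      linarith)
    (fun r x => by
      rw [Real.mul_iSup_of_nonneg (norm_nonneg r)]
      congr 1
      funext φ
      rw [φ.2.1.1.smul, abs_mul, Real.norm_eq_abs]
      ring)

lemma one_add_mul_abs_le_supSeminorm (hε : IsRigidPerturbation D ε) (hs : Summable ε) {φ : X → ℝ}
    (hφ : φ ∈ homSphere X) (x : X) : (1 + ε φ) * |φ x| ≤ supSeminorm hε hs x :=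
  le_ciSup (bddAbove_one_add_mul_abs hε hs x) ⟨φ, hφ⟩

lemma supSeminorm_le {hε : IsRigidPerturbation D ε} {hs : Summable ε} {x : X} {a : ℝ}
    (ha : 0 ≤ a) (h : ∀ φ ∈ homSphere X, (1 + ε φ) * |φ x| ≤ a) : supSeminorm hε hs x ≤ a :=
  Real.iSup_le (fun φ => h φ.1 φ.2) ha

lemma supSeminorm_le_sumSeminorm (hε : IsRigidPerturbation D ε) (hs : Summable ε) (x : X) :
    supSeminorm hε hs x ≤ sumSeminorm hε hs x :=
  supSeminorm_le (apply_nonneg _ _) fun _ hφ => one_add_mul_abs_le_sumSeminorm hε hs hφ x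

lemma abs_apply_le_of_abs_le {φ : X → ℝ} (hφ : φ ∈ homSphere X) {x y : X} (h : |x| ≤ |y|) :
    |φ x| ≤ |φ y| := by
  rw [← hφ.1.1.abs, ← hφ.1.1.abs]
  exact hφ.1.1.mono h

variable [IsOrderedAddMonoid X] [IsOrderedModule ℝ X] [HasSolidNorm X]

lemma isLatticeNorm_sumSeminorm (hε : IsRigidPerturbation D ε) (hs : Summable ε) :
    IsLatticeNorm (sumSeminorm hε hs) where
  eq_zero_of_map_eq_zero x hx := by
    have : 0 ≤ ∑' φ, ε φ * |φ x| :=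
      tsum_nonneg fun φ => mul_nonneg (hε.nonneg φ) (abs_nonneg _)
    rw [sumSeminorm_apply] at hx
    exact norm_eq_zero.1 (le_antisymm (by linarith) (norm_nonneg x))
  solid x y h := by
    refine add_le_add (norm_le_norm_of_abs_le_abs h)
      ((hε.summable_mul_abs hs x).tsum_le_tsum (fun φ => ?_) (hε.summable_mul_abs hs y))
    by_cases hφ : φ ∈ D
    · exact mul_le_mul_of_nonneg_left (abs_apply_le_of_abs_le (hε.subset hφ) h) (hε.nonneg φ)
    · simp [hε.eq_zero φ hφ]

lemma isAMNorm_supSeminorm (hX : IsAMNorm (normSeminorm ℝ X)) (hε : IsRigidPerturbation D ε)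
    (hs : Summable ε) : IsAMNorm (supSeminorm hε hs) := by
  have nonneg : ∀ φ, 0 ≤ 1 + ε φ := fun φ => by linarith [hε.nonneg φ]
  have solid : ∀ x y : X, |x| ≤ |y| → supSeminorm hε hs x ≤ supSeminorm hε hs y := fun x y h =>
    supSeminorm_le (apply_nonneg _ _) fun φ hφ =>
      (mul_le_mul_of_nonneg_left (abs_apply_le_of_abs_le hφ h) (nonneg φ)).trans
        (one_add_mul_abs_le_supSeminorm hε hs hφ y)
  refine ⟨⟨fun x hx => ?_, solid⟩, fun x y hx hy => le_antisymm ?_ (max_le ?_ ?_)⟩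
  · have := norm_le_of_one_add_mul_abs_le hX hε
      (fun φ hφ => one_add_mul_abs_le_supSeminorm hε hs hφ) x
    exact norm_eq_zero.1 (le_antisymm (this.trans_eq hx) (norm_nonneg x))
  · refine supSeminorm_le (le_max_of_le_left (apply_nonneg _ _)) fun φ hφ => ?_
    have hx' := hφ.1.1.nonneg hx
    have hy' := hφ.1.1.nonneg hy
    rw [hφ.1.1.sup, abs_of_nonneg (le_max_of_le_left hx'), mul_max_of_nonneg _ _ (nonneg φ)]
    refine max_le_max ?_ ?_
    · rw [← abs_of_nonneg hx']
      exact one_add_mul_abs_le_supSeminorm hε hs hφ x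
    · rw [← abs_of_nonneg hy']
      exact one_add_mul_abs_le_supSeminorm hε hs hφ y
  · exact solid _ _ (by
      rw [abs_of_nonneg hx, abs_of_nonneg (hx.trans le_sup_left)]; exact le_sup_left)
  · exact solid _ _ (by
      rw [abs_of_nonneg hy, abs_of_nonneg (hy.trans le_sup_right)]; exact le_sup_right)

lemma IsPeakAtom.apply_eq_zero {φ ψ : X → ℝ} {a : X} (ha : IsPeakAtom φ a) (hφ : φ ∈ homSphere X)
    (hψ : ψ ∈ homSphere X) (hne : ψ ≠ φ) : ψ a = 0 :=
  ha.apply_of_ne ψ hψ.1 fun _ hr => hne (homSphere_eq_of_eq_smul hφ hψ hr)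

/-- Among homomorphisms of norm one only `φ` and `ψ` see the span of `a` and `b`, so the original
norm is the larger coefficient `s` and the sum has two terms. -/
lemma sumSeminorm_add_peakAtom (hX : IsAMNorm (normSeminorm ℝ X)) (hε : IsRigidPerturbation D ε)
    (hs : Summable ε) {φ ψ : X → ℝ} (hφ : φ ∈ D) (hψ : ψ ∈ D) (hne : φ ≠ ψ) {a b : X}
    (ha : IsPeakAtom φ a) (hb : IsPeakAtom ψ b) {s t : ℝ} (hs0 : 0 < s) (ht0 : 0 ≤ t)
    (hts : t ≤ s) : sumSeminorm hε hs (s • a + t • b) = s + (ε φ * s + ε ψ * t) := by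
  classical
  have hφS := hε.subset hφ
  have hψS := hε.subset hψ
  have e1 : φ (s • a + t • b) = s := by
    rw [hφS.1.1.add, hφS.1.1.smul, hφS.1.1.smul, ha.apply_self, hb.apply_eq_zero hψS hφS hne]
    ring
  have e2 : ψ (s • a + t • b) = t := by
    rw [hψS.1.1.add, hψS.1.1.smul, hψS.1.1.smul, hb.apply_self, ha.apply_eq_zero hφS hψS hne.symm]
    ring
  have e3 : ∀ χ ∈ homSphere X, χ ≠ φ → χ ≠ ψ → χ (s • a + t • b) = 0 := fun χ hχ h1 h2 => by
    rw [hχ.1.1.add, hχ.1.1.smul, hχ.1.1.smul, ha.apply_eq_zero hφS hχ h1,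
      hb.apply_eq_zero hψS hχ h2]
    ring
  rw [sumSeminorm_apply]
  congr 1
  · have hne0 : s • a + t • b ≠ 0 := fun h => by
      rw [h, hφS.1.1.zero] at e1
      exact hs0.ne e1
    obtain ⟨χ, hχ, hχn⟩ := exists_homSphere_abs_eq_norm hX hne0
    apply le_antisymm
    · rw [← hχn]
      by_cases h1 : χ = φ
      · rw [h1, e1, abs_of_pos hs0]
      by_cases h2 : χ = ψ
      · rwa [h2, e2, abs_of_nonneg ht0]
      rw [e3 χ hχ h1 h2, abs_zero]
      exact hs0.le
    · have := hφS.1.2 (s • a + t • b)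
      rwa [e1, abs_of_pos hs0] at this
  · rw [tsum_eq_sum (s := {φ, ψ}), Finset.sum_pair hne, e1, e2, abs_of_pos hs0, abs_of_nonneg ht0]
    intro χ hχ
    simp only [Finset.mem_insert, Finset.mem_singleton, not_or] at hχ
    by_cases hχD : χ ∈ D
    · rw [e3 χ (hε.subset hχD) hχ.1 hχ.2, abs_zero, mul_zero]
    · rw [hε.eq_zero χ hχD, zero_mul]

/-- A lattice isometry maps peak atoms to multiples of peak atoms. -/
lemma map_peakAtom (hX : IsAMNorm (normSeminorm ℝ X)) {N : Seminorm ℝ X} {c : ℝ}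
    (hN : IsGaugedBy N ε c) {T : X →ₗ[ℝ] X} (hT : IsLatticeIsometry N T) {φ ψ : X → ℝ}
    (hφ : φ ∈ homSphere X) (hψ : ψ ∈ homSphere X) {u : ℝ} (h : φ ∘ T = u • ψ) (hu : 0 < u)
    {a b : X} (ha : IsPeakAtom φ a) (hb : IsPeakAtom ψ b) : T b = u • a := by
  refine eq_of_forall_homSphere hX fun χ hχ => ?_
  rw [hχ.1.1.smul]
  by_cases hχφ : χ = φ
  · have := congrFun h b
    simp only [Function.comp_apply, Pi.smul_apply, smul_eq_mul] at this
    rw [hχφ, this, ha.apply_self, hb.apply_self]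
  · rw [ha.apply_eq_zero hφ hχ hχφ, mul_zero]
    obtain ⟨θ, hθ, v, -, hχθ, -⟩ := hN.exists_comp_eq_smul hT hχ
    have hθψ : θ ≠ ψ := by
      rintro rfl
      refine hχφ (homSphere_eq_of_eq_smul hφ hχ (r := v * u⁻¹) ?_)
      apply hT.surjective.injective_comp_right
      simp only
      rw [hχθ]
      funext x
      have := congrFun h x
      simp only [Function.comp_apply, Pi.smul_apply, smul_eq_mul] at this ⊢
      rw [this]
      field_simp
    have := congrFun hχθ b
    simp only [Function.comp_apply, Pi.smul_apply, smul_eq_mul] at this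
    rw [this, hb.apply_eq_zero hψ hθ hθψ, mul_zero]

/-- An isometry is trivial as soon as its adjoint does not move the functionals of atoms. -/
lemma eq_id_of_fixes_atoms (hX : IsAMNorm (normSeminorm ℝ X)) (hε : IsRigidPerturbation D ε)
    {N : Seminorm ℝ X} {c : ℝ} (hN : IsGaugedBy N ε c) {T : X →ₗ[ℝ] X}
    (hT : IsLatticeIsometry N T)
    (h : ∀ φ ∈ D, ∀ ψ ∈ D, ∀ u : ℝ, 0 < u → φ ∘ T = u • ψ → u * (1 + ε φ) = 1 + ε ψ →
      accumHeight φ = 0 → accumHeight ψ = 0 → φ = ψ) : T = LinearMap.id := by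
  refine eq_id_of_comp_eq hX hε.dense fun φ hφ => ?_
  obtain ⟨ψ, hψ, u, hu, hφψ, h1, h2, h3⟩ := hε.comp_eq hN hT hφ
  have heq : φ = ψ := by
    by_cases h0 : accumHeight φ = 0
    · exact h φ hφ ψ hψ u hu hφψ h1 h0 (h3 h0)
    · exact h2 h0
  subst heq
  have hpos : 1 + ε φ ≠ 0 := by linarith [hε.nonneg φ]
  rw [hφψ, (mul_eq_right₀ hpos).1 h1, one_smul]

variable [CompleteSpace X]

theorem eq_id_of_isLatticeIsometry_sumSeminorm (hX : IsAMNorm (normSeminorm ℝ X))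
    (hε : IsRigidPerturbation D ε) (hs : Summable ε) {T : X →ₗ[ℝ] X}
    (hT : IsLatticeIsometry (sumSeminorm hε hs) T) : T = LinearMap.id := by
  have hN := isGaugedBy_of_le_sumSeminorm hX hε hs
    (fun φ hφ => one_add_mul_abs_le_sumSeminorm hε hs hφ) (fun _ => le_rfl)
  refine eq_id_of_fixes_atoms hX hε hN hT fun φ hφ ψ hψ u hu hφψ hu1 hφ0 hψ0 => ?_
  by_contra hne
  have hφS := hε.subset hφ
  have hψS := hε.subset hψ
  -- A second application of the adjoint gives `T d = v • b` and `T b = u • a` for the corresponding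
  -- atoms; `θ = φ` is not excluded.
  obtain ⟨θ, hθ, v, hv, hψθ, hv1, -, hθ0⟩ := hε.comp_eq hN hT hψ
  have hθS := hε.subset hθ
  have hθψ : θ ≠ ψ := by
    rintro rfl
    refine hne (homSphere_eq_of_eq_smul hψS hφS (r := u * v⁻¹) ?_)
    apply hT.surjective.injective_comp_right
    simp only
    rw [hφψ]
    funext x
    have := congrFun hψθ x
    simp only [Function.comp_apply, Pi.smul_apply, smul_eq_mul] at this ⊢
    rw [this]
    field_simp
  obtain ⟨a, ha⟩ := exists_isPeakAtom hX hφS hφ0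
  obtain ⟨b, hb⟩ := exists_isPeakAtom hX hψS hψ0
  obtain ⟨d, hd⟩ := exists_isPeakAtom hX hθS (hθ0 hψ0)
  have hTb := map_peakAtom hX hN hT hφS hψS hφψ hu ha hb
  have hTd := map_peakAtom hX hN hT hψS hθS hψθ hv hb hd
  -- With this `r` the first coefficient dominates both in `d + r • b` and in its image `v • b + (r
  -- * u) • a`, so the norm formula applies to both.
  set r := min 1 (v / u)
  have hr : 0 < r := lt_min one_pos (div_pos hv hu)
  have hr1 : r ≤ 1 := min_le_left _ _
  have hrv : r * u ≤ v := (le_div_iff₀ hu).1 (min_le_right _ _)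
  have n1 := sumSeminorm_add_peakAtom hX hε hs hθ hψ hθψ hd hb one_pos hr.le hr1
  have n2 := sumSeminorm_add_peakAtom hX hε hs hψ hφ (Ne.symm hne) hb ha hv
    (mul_nonneg hr.le hu.le) hrv
  have n3 := hT.isometry ((1 : ℝ) • d + r • b)
  rw [map_add, map_smul, map_smul, hTd, hTb, one_smul ℝ (v • b), smul_smul, n2, n1] at n3
  -- The leading terms cancel by `v * (1 + ε ψ) = 1 + ε θ`. What remains is `u * ε φ = ε ψ`, and
  -- with `u * (1 + ε φ) = 1 + ε ψ` this gives `u = 1`.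
  have h4 : r * (u * ε φ) = r * ε ψ := by linarith
  have h5 := mul_left_cancel₀ hr.ne' h4
  have h6 : u = 1 := by linarith
  rw [h6, one_mul] at h5
  exact hne (hε.inj_zero φ hφ ψ hψ hφ0 hψ0 h5)

theorem eq_id_of_isLatticeIsometry_supSeminorm (hX : IsAMNorm (normSeminorm ℝ X))
    (hatom : HasAtMostOneAtom X) (hε : IsRigidPerturbation D ε) (hs : Summable ε) {T : X →ₗ[ℝ] X}
    (hT : IsLatticeIsometry (supSeminorm hε hs) T) : T = LinearMap.id := by
  have hN := isGaugedBy_of_le_sumSeminorm hX hε hs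
    (fun φ hφ => one_add_mul_abs_le_supSeminorm hε hs hφ) (supSeminorm_le_sumSeminorm hε hs)
  refine eq_id_of_fixes_atoms hX hε hN hT fun φ hφ ψ hψ u hu hφψ hu1 hφ0 hψ0 => ?_
  by_contra hne
  have hφS := hε.subset hφ
  have hψS := hε.subset hψ
  obtain ⟨a, ha⟩ := exists_isPeakAtom hX hφS hφ0
  obtain ⟨b, hb⟩ := exists_isPeakAtom hX hψS hψ0
  obtain ⟨r, -, hr⟩ := hatom a b (ha.isLatticeAtom hX hφS) (hb.isLatticeAtom hX hψS)
  have h1 := hb.apply_self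
  rw [hr, hψS.1.1.smul, ha.apply_eq_zero hφS hψS (Ne.symm hne), mul_zero] at h1
  exact zero_ne_one h1

end Rigidity

theorem theorem1p1 {X : Type*} [NormedAddCommGroup X] [NormedSpace ℝ X] [CompleteSpace X]
    [TopologicalSpace.SeparableSpace X]
    [Lattice X] [IsOrderedAddMonoid X] [IsOrderedModule ℝ X]
    (hX : IsAMNorm (normSeminorm ℝ X)) (c : ℝ) (hc : 1 < c) :
    (∃ N : Seminorm ℝ X, IsLatticeNorm N ∧
      (∀ x : X, ‖x‖ ≤ N x ∧ N x ≤ c * ‖x‖) ∧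
      ∀ T : X →ₗ[ℝ] X, IsLatticeIsometry N T ↔ T = LinearMap.id) ∧
    (HasAtMostOneAtom X →
      ∃ N : Seminorm ℝ X, IsAMNorm N ∧
        (∀ x : X, ‖x‖ ≤ N x ∧ N x ≤ c * ‖x‖) ∧
        ∀ T : X →ₗ[ℝ] X, IsLatticeIsometry N T ↔ T = LinearMap.id) := by
  have : HasSolidNorm X := ⟨fun x y h => hX.solid x y h⟩
  obtain ⟨D, ε, hε, hs, hsum⟩ := exists_isRigidPerturbation (X := X) (sub_pos.2 hc)
  have hle : ∀ x : X, sumSeminorm hε hs x ≤ c * ‖x‖ := fun x =>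
    (sumSeminorm_le hε hs x).trans (mul_le_mul_of_nonneg_right (by linarith) (norm_nonneg x))
  refine ⟨⟨sumSeminorm hε hs, isLatticeNorm_sumSeminorm hε hs, fun x => ⟨?_, hle x⟩, fun T =>
      ⟨eq_id_of_isLatticeIsometry_sumSeminorm hX hε hs, ?_⟩⟩,
    fun hatom => ⟨supSeminorm hε hs, isAMNorm_supSeminorm hX hε hs, fun x =>
      ⟨?_, (supSeminorm_le_sumSeminorm hε hs x).trans (hle x)⟩, fun T =>
      ⟨eq_id_of_isLatticeIsometry_supSeminorm hX hatom hε hs, ?_⟩⟩⟩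
  · exact norm_le_of_one_add_mul_abs_le hX hε
      (fun φ hφ => one_add_mul_abs_le_sumSeminorm hε hs hφ) x
  · rintro rfl
    exact isLatticeIsometry_id _
  · exact norm_le_of_one_add_mul_abs_le hX hε
      (fun φ hφ => one_add_mul_abs_le_supSeminorm hε hs hφ) x
  · rintro rfl
    exact isLatticeIsometry_id _
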